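/- Let $n\ge 8$, $p\in[1,2]$, $\frac1p+\frac1q=1$ (so $q\in[2,\infty]$), and $\rho_n=\min\{q-1,\,16\ln n-8\}\,n^{\frac2q-1}$. Let $d:\mathbb R^n\to\mathbb R$ be a prox-function, i.e. differentiable and $1$-strongly convex with respect to $\|\cdot\|_p$: $d(y)-d(x)-\langle\nabla d(x),y-x\rangle\ge\frac12\|y-x\|_p^2$ for all $x,y$; let $V[z](x)=d(x)-d(z)-\langle\nabla d(z),x-z\rangle$. (Admissible choices are $d(x)=\frac{\mathrm e\, n^{(\kappa-1)(2-\kappa)/\kappa}\ln n}{2}\|x\|_\kappa^2$ with $\kappa=1+\frac1{\ln n}$ for $p=1$, and $d(x)=\frac12\|x\|_2^2$ for $p=2$; that these are prox-functions is part of the claim.) Let $\xi$ be a random element with distribution $P$, let $f(x)=\mathbb E_\xi F(x,\xi)$ be convex on $\mathbb R^n$ with a minimizer $x^*$, and let, for $P$-almost every $\xi$, $F(\cdot,\xi)$ have a gradient $g(\cdot,\xi)$ that is $L(\xi)$-Lipschitz in the Euclidean norm, with $0<L_2:=\sqrt{\mathbb E_\xi L(\xi)^2}<\infty$ and $\mathbb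 E_\xi\|g(x,\xi)-\nabla f(x)\|_2^2\le\sigma^2$ for all $x$. One oracle call at a pair $(x,y)$ returns $(\widetilde f(x,\xi),\widetilde f(y,\xi))$ for a realization $\xi$, where $\widetilde f=F+\eta$ and, almost surely in $\xi$, $|\eta(x,\xi)|\le\Delta$ for all $x$. RDFDS, started at $x_0$, with step size $\alpha=\frac{1}{48n\rho_nL_2}$, performs for $k=0,\dots,N-1$ the step $$x_{k+1}=\mathop{\arg\min}_{x\in\mathbb R^n}\Big\{\alpha n\Big\langle \frac1m\sum_{i=1}^m\frac{\widetilde f(x_k+te_{k+1},\xi_{k+1,i})-\widetilde f(x_k,\xi_{k+1,i})}{t}\,e_{k+1},\;x-x_k\Big\rangle+V[x_k](x)\Big\},$$ where $e_{k+1}$ is uniform on the unit Euclidean sphere, $\xi_{k+1,i}\sim P$, and all these variables are independent; it returns $\bar x_N=\frac1N\sum_{k=0}^{N-1}x_k$. Let $\Theta_p=V[x_0](x^*)$ and $\varepsilon>0$. There is a universal constant $c_0>0$ such that for every $C\ge c_0$ there is a constant $c_1>0$, depending only on $C$, such that the following holds for all data as above. Let the integers $N,m\ge1$ satisfy $$c_0\,\frac{n\rho_nL_2\Theta_p}{\varepsilon}\le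 N\le C\max\Big\{1,\frac{n\rho_nL_2\Theta_p}{\varepsilon}\Big\},\qquad c_0\,\frac{\sigma^2}{\varepsilon L_2}\le m\le C\max\Big\{1,\frac{\sigma^2}{\varepsilon L_2}\Big\},$$ and let $0<\Delta\le c_1\min\big\{\frac{\varepsilon}{n},\frac{\varepsilon^2}{nL_2\Theta_p}\big\}$ and $t=2\sqrt{\Delta/L_2}$ (the second entries of the minima are $+\infty$ if $\Theta_p=0$). Then $t\le C\min\big\{\sqrt{\frac{\varepsilon}{nL_2}},\frac{\varepsilon}{\sqrt{nL_2^2\Theta_p}}\big\}$, $$\mathbb E f(\bar x_N)-f(x^*)\le\varepsilon,$$ and the total number of oracle calls is $Nm\le C^2\max\{1,\frac{n\rho_nL_2\Theta_p}{\varepsilon}\}\max\{1,\frac{\sigma^2}{\varepsilon L_2}\}$. In particular, if $\varepsilon\le n\rho_nL_2\Theta_p$, then $$Nm\le C^2\max\Big\{\frac{n\rho_nL_2\Theta_p}{\varepsilon},\frac{n\rho_n\sigma^2\Theta_p}{\varepsilon^2}\Big\},$$ and if moreover $p=1$, then the number of oracle calls depends on the dimension, for given $\Theta_1$, only through a logarithm: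 $$Nm\le 16\,C^2\max\Big\{\frac{L_2\Theta_1\ln n}{\varepsilon},\frac{\sigma^2\Theta_1\ln n}{\varepsilon^2}\Big\}.$$ -/

import Mathlib

open MeasureTheory ProbabilityTheory

noncomputable section

namespace ZerothOrder

/-- `ℝⁿ` with the Euclidean norm and inner product. -/
abbrev Vec (n : ℕ) := EuclideanSpace ℝ (Fin n)

/-- The norm `‖x‖_p = (∑ i, |x i| ^ p) ^ (1 / p)` on `ℝⁿ`. -/
def lpNorm {n : ℕ} (p : ℝ) (x : Vec n) : ℝ :=
  (∑ i, |x i| ^ p) ^ (1 / p)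

/-- A prox-function: a differentiable function on `ℝⁿ` that is `1`-strongly convex with respect
to `‖·‖_p` (in particular it is continuous and convex). -/
structure IsProxFunction {n : ℕ} (p : ℝ) (d : Vec n → ℝ) : Prop where
  differentiable : Differentiable ℝ d
  strongly_convex : ∀ x y : Vec n,
    1 / 2 * lpNorm p (y - x) ^ 2 ≤ d y - d x - inner ℝ (gradient d x) (y - x)

/-- The Bregman divergence `V[z](x)` of `d`. -/
def bregman {n : ℕ} (d : Vec n → ℝ) (z x : Vec n) : ℝ :=
  d x - d z - inner ℝ (gradient d z) (x - z)

/-- The exponent `κ = 1 + 1 / ln n`. -/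
def kappa (n : ℕ) : ℝ := 1 + 1 / Real.log n

/-- The prox-function chosen for `p = 1`. -/
def proxOne (n : ℕ) (x : Vec n) : ℝ :=
  Real.exp 1 * (n : ℝ) ^ ((kappa n - 1) * (2 - kappa n) / kappa n) * Real.log n / 2
    * lpNorm (kappa n) x ^ 2

/-- The prox-function chosen for `p = 2`. -/
def proxTwo (n : ℕ) (x : Vec n) : ℝ := 1 / 2 * ‖x‖ ^ 2

/-- `ρ_n = min {q - 1, 16 ln n - 8} * n ^ (2 / q - 1)` with `1 / p + 1 / q = 1`.
Here `1 / q = 1 - 1 / p`, and `q = p / (p - 1)` for `p > 1`. For `p = 1` one has `q = ∞`,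
so that the minimum is its second entry. -/
def rho (p : ℝ) (n : ℕ) : ℝ :=
  (if p = 1 then 16 * Real.log n - 8 else min (p / (p - 1) - 1) (16 * Real.log n - 8))
    * (n : ℝ) ^ (2 * (1 - 1 / p) - 1)

/-- The uniform probability distribution on the unit Euclidean sphere of `ℝⁿ`, as a measure on
`ℝⁿ`: the normalized surface measure. -/
def sphereUniform (n : ℕ) : Measure (Vec n) :=
  (((volume : Measure (Vec n)).toSphere Set.univ)⁻¹ •
    (volume : Measure (Vec n)).toSphere).map Subtype.val

section Problem

variable {𝒳 : Type*} [MeasurableSpace 𝒳] {n : ℕ}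

/-- The objective `f(x) = E_ξ F(x, ξ)`, where `ξ` has distribution `P`. -/
def objective (P : Measure 𝒳) (F : Vec n → 𝒳 → ℝ) (x : Vec n) : ℝ := ∫ ξ, F x ξ ∂P

/-- The constant `L₂ = (E_ξ L(ξ)²) ^ (1 / 2)`. -/
def smoothConst (P : Measure 𝒳) (L : 𝒳 → ℝ) : ℝ := √(∫ ξ, L ξ ^ 2 ∂P)

/-- The assumptions on the stochastic optimization problem `min_x E_ξ F(x, ξ)`. The stochastic
gradient `g(x, ξ)` is the gradient of `F(·, ξ)` at `x`. -/
structure IsSmoothStochasticProblem (P : Measure 𝒳) (F : Vec n → 𝒳 → ℝ) (L : 𝒳 → ℝ) (σ : ℝ) :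
    Prop where
  measurable : Measurable (Function.uncurry F)
  integrable : ∀ x, Integrable (F x) P
  convex : ConvexOn ℝ Set.univ (objective P F)
  differentiable : ∀ᵐ ξ ∂P, Differentiable ℝ fun x => F x ξ
  lipschitz : ∀ᵐ ξ ∂P, ∀ x y,
    ‖gradient (fun u => F u ξ) x - gradient (fun u => F u ξ) y‖ ≤ L ξ * ‖x - y‖
  memLp : MemLp L 2 P
  variance_integrable : ∀ x, Integrable
    (fun ξ => ‖gradient (fun u => F u ξ) x - gradient (objective P F) x‖ ^ 2) P
  variance_le : ∀ x,
    ∫ ξ, ‖gradient (fun u => F u ξ) x - gradient (objective P F) x‖ ^ 2 ∂P ≤ σ ^ 2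

/-- `η` is an admissible noise of level `Δ`: `|η(x, ξ)| ≤ Δ` for all `x`, almost surely in `ξ`. -/
structure IsBoundedNoise (P : Measure 𝒳) (η : Vec n → 𝒳 → ℝ) (Δ : ℝ) : Prop where
  measurable : Measurable (Function.uncurry η)
  bound : ∀ᵐ ξ ∂P, ∀ x, |η x ξ| ≤ Δ

/-- One call of the two-point oracle at `(x + t e, x)` with realization `ξ`: the resulting finite
difference along `e`, together with its cost, one oracle call. Here `fn x ξ` is the noisy
value at `x`. -/
def oracleDiff (fn : Vec n → 𝒳 → ℝ) (t : ℝ) (x e : Vec n) (ξ : 𝒳) : Vec n × ℕ :=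
  (((fn (x + t • e) ξ - fn x ξ) / t) • e, 1)

/-- The mini-batch approximation of the gradient at `x`, together with the number of oracle calls
spent on it. -/
def gradEst (fn : Vec n → 𝒳 → ℝ) (t : ℝ) {m : ℕ} (x e : Vec n) (ξ : Fin m → 𝒳) : Vec n × ℕ :=
  let s := ∑ i, oracleDiff fn t x e (ξ i)
  ((1 / (m : ℝ)) • s.1, s.2)

/-- A global minimizer of `φ` (an arbitrary point if there is none). -/
def argminPt (φ : Vec n → ℝ) : Vec n :=
  Classical.epsilon fun x => ∀ y, φ x ≤ φ y

/-- The Randomized Derivative-Free Directional Search: the point `x_k` after `k` iterations,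
started at `x₀`, with prox-function `d`, step size `α` and smoothing parameter `t`, together
with the number of oracle calls made so far. In iteration `k` it uses the direction `e k` and the
batch of realizations `ξ k`. -/
def rdfds (d : Vec n → ℝ) (fn : Vec n → 𝒳 → ℝ) (α t : ℝ) {m : ℕ} (e : ℕ → Vec n)
    (ξ : ℕ → Fin m → 𝒳) (x₀ : Vec n) : ℕ → Vec n × ℕ
  | 0 => (x₀, 0)
  | k + 1 =>
    let s := rdfds d fn α t e ξ x₀ k
    let g := gradEst fn t s.1 (e k) (ξ k)
    (argminPt fun u => α * n * inner ℝ g.1 (u - s.1) + bregman d s.1 u, s.2 + g.2)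

/-- The output `(1 / N) ∑_{k < N} x_k` of the method after `N` iterations. -/
def rdfdsOutput (d : Vec n → ℝ) (fn : Vec n → 𝒳 → ℝ) (α t : ℝ) {m : ℕ} (e : ℕ → Vec n)
    (ξ : ℕ → Fin m → 𝒳) (x₀ : Vec n) (N : ℕ) : Vec n :=
  (1 / (N : ℝ)) • ∑ k ∈ Finset.range N, (rdfds d fn α t e ξ x₀ k).1

/-- The random input of the method on a probability space `(Ω, μ)`: in every iteration, `e k` is
uniformly distributed on the unit sphere, `ξ k 0, …, ξ k (m - 1)` have distribution `P`, these
`m + 1` variables are independent, and the iterations are independent of each other. -/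
structure IsSampling {Ω : Type*} [MeasurableSpace Ω] (μ : Measure Ω) (P : Measure 𝒳)
    [SigmaFinite P] {m : ℕ} (e : ℕ → Ω → Vec n) (ξ : ℕ → Ω → Fin m → 𝒳) : Prop where
  law : ∀ k, HasLaw (fun ω => (e k ω, ξ k ω))
    ((sphereUniform n).prod (Measure.pi fun _ : Fin m => P)) μ
  indep : iIndepFun (fun k ω => (e k ω, ξ k ω)) μ

end Problem

end ZerothOrder

end

open ZerothOrder

noncomputable section

namespace ZerothOrder

section Sphere

variable {n : ℕ}

instance isProbabilityMeasure_sphereUniform [NeZero n] :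
    IsProbabilityMeasure (sphereUniform n) := by
  have : IsProbabilityMeasure (((volume : Measure (Vec n)).toSphere Set.univ)⁻¹ •
      (volume : Measure (Vec n)).toSphere) := by
    constructor
    rw [Measure.smul_apply, smul_eq_mul, ENNReal.inv_mul_cancel]
    · exact Measure.measure_univ_ne_zero.2 (Measure.toSphere_ne_zero _)
    · exact measure_ne_top _ _
  exact Measure.isProbabilityMeasure_map measurable_subtype_coe.aemeasurable

lemma ae_norm_eq_one_sphereUniform : ∀ᵐ e ∂(sphereUniform n), ‖e‖ = 1 := by
  rw [sphereUniform, ae_map_iff measurable_subtype_coe.aemeasurable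
    (measurableSet_eq_fun measurable_norm measurable_const)]
  exact ae_of_all _ fun x => by simp

/-- The standard Gaussian density on `ℝⁿ`. -/
def gaussDensity (x : Vec n) : ℝ := ∏ i, gaussianPDFReal 0 1 (x i)

lemma gaussDensity_eq (x : Vec n) :
    gaussDensity x = (√(2 * Real.pi))⁻¹ ^ n * Real.exp (-(‖x‖ ^ 2) / 2) := by
  simp [gaussDensity, gaussianPDFReal, Finset.prod_mul_distrib, ← Real.exp_sum,
    EuclideanSpace.norm_sq_eq, ← Finset.sum_div]

lemma exists_integral_homogeneous (n : ℕ) [NeZero n] : ∃ K : ℝ, ∀ φ : Vec n → ℝ,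
    (∀ (r : ℝ) (x : Vec n), 0 < r → φ (r • x) = r ^ 2 * φ x) →
    ∫ x, φ x * gaussDensity x = K * ∫ e, φ e ∂(sphereUniform n) := by
  set S := (volume : Measure (Vec n)).toSphere
  have hS0 : S Set.univ ≠ 0 := Measure.measure_univ_ne_zero.2 (Measure.toSphere_ne_zero _)
  have hS1 : S Set.univ ≠ ⊤ := measure_ne_top _ _
  refine ⟨(√(2 * Real.pi))⁻¹ ^ n * (S Set.univ).toReal * ∫ r : Set.Ioi (0 : ℝ), (r : ℝ) ^ 2 * Real.exp (-((r : ℝ) ^ 2) / 2)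
    ∂Measure.volumeIoiPow (Module.finrank ℝ (Vec n) - 1), fun φ hφ => ?_⟩
  have h1 : ∫ e, φ e ∂(sphereUniform n) = (S Set.univ).toReal⁻¹ * ∫ e, φ e ∂S := by
    rw [sphereUniform, (MeasurableEmbedding.subtype_coe
      Metric.isClosed_sphere.measurableSet).integral_map, integral_smul_measure]
    simp [S]
  rw [h1]
  have h2 : ∫ x, φ x * gaussDensity x
      = ∫ x : ({(0)}ᶜ : Set (Vec n)), φ x * gaussDensity (x : Vec n)
        ∂((volume : Measure (Vec n)).comap (↑)) := by
    rw [integral_subtype_comap (measurableSet_singleton _).compl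
      fun x : Vec n => φ x * gaussDensity x, restrict_compl_singleton]
  have h3 := (volume : Measure (Vec n)).measurePreserving_homeomorphUnitSphereProd.integral_comp
        (Homeomorph.measurableEmbedding _)
        (fun z => φ z.1 * ((√(2 * Real.pi))⁻¹ ^ n * (z.2 : ℝ) ^ 2 * Real.exp (-((z.2 : ℝ) ^ 2) / 2)))
  rw [integral_prod_mul (fun z : Metric.sphere (0 : Vec n) 1 => φ z)
    (fun r : Set.Ioi (0 : ℝ) => (√(2 * Real.pi))⁻¹ ^ n * (r : ℝ) ^ 2 * Real.exp (-((r : ℝ) ^ 2) / 2))] at h3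
  rw [h2]
  have h4 : ∀ x : ({(0)}ᶜ : Set (Vec n)), φ x * gaussDensity (x : Vec n)
      = φ (homeomorphUnitSphereProd (Vec n) x).1 *
        ((√(2 * Real.pi))⁻¹ ^ n * ((homeomorphUnitSphereProd (Vec n) x).2 : ℝ) ^ 2 *
          Real.exp (-(((homeomorphUnitSphereProd (Vec n) x).2 : ℝ) ^ 2) / 2)) := by
    intro x
    have hx : 0 < ‖(x : Vec n)‖ := norm_pos_iff.2 x.2
    have : φ (x : Vec n) = ‖(x : Vec n)‖ ^ 2 * φ (‖(x : Vec n)‖⁻¹ • (x : Vec n)) := by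
      rw [← hφ _ _ hx, smul_smul, mul_inv_cancel₀ hx.ne', one_smul]
    simp only [homeomorphUnitSphereProd_apply_snd_coe, homeomorphUnitSphereProd_apply_fst_coe,
      gaussDensity_eq]
    rw [this]; ring
  simp only [mul_assoc, integral_const_mul] at h3 h4 ⊢
  rw [integral_congr_ae (ae_of_all _ h4), h3]
  have : (S Set.univ).toReal ≠ 0 := ENNReal.toReal_ne_zero.2 ⟨hS0, hS1⟩
  field_simp
  ring

lemma integral_prod_gaussDensity (f : Fin n → ℝ → ℝ) :
    ∫ x : Vec n, (∏ i, f i (x i)) * gaussDensity x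
      = ∏ i, ∫ y, f i y * gaussianPDFReal 0 1 y := by
  rw [← integral_fintype_prod_volume_eq_prod,
    ← (PiLp.volume_preserving_ofLp (Fin n)).integral_comp
      (MeasurableEquiv.toLp 2 (Fin n → ℝ)).symm.measurableEmbedding]
  simp [gaussDensity, Finset.prod_mul_distrib]

lemma integral_gaussDensity : ∫ x : Vec n, gaussDensity x = 1 := by
  have := integral_prod_gaussDensity (n := n) (fun _ _ => 1)
  simpa [integral_gaussianPDFReal_eq_one] using this

lemma integral_coord_gaussDensity (i : Fin n) (f : ℝ → ℝ) :
    ∫ x : Vec n, f (x i) * gaussDensity x = ∫ y, f y * gaussianPDFReal 0 1 y := by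
  have := integral_prod_gaussDensity (n := n) (fun j y => if j = i then f y else 1)
  rw [Finset.prod_eq_single i] at this
  · simpa using this
  · intro j _ hj; simp [hj, integral_gaussianPDFReal_eq_one]
  · simp

lemma integrable_coord_gaussDensity (i : Fin n) {f : ℝ → ℝ}
    (hf : Integrable fun y => f y * gaussianPDFReal 0 1 y) :
    Integrable fun x : Vec n => f (x i) * gaussDensity x := by
  have := Integrable.fintype_prod (μ := fun _ : Fin n => (volume : Measure ℝ))
    (f := fun j y => (if j = i then f y else 1) * gaussianPDFReal 0 1 y) (fun j => by
      by_cases hj : j = i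
      · simpa [hj] using hf
      · simpa [hj] using integrable_gaussianPDFReal 0 1)
  have h2 := (PiLp.volume_preserving_ofLp (Fin n)).integrable_comp_of_integrable this
  refine h2.congr (ae_of_all _ fun x => ?_)
  simp only [gaussDensity, Function.comp, Finset.prod_mul_distrib]
  simp

lemma integrable_gaussDensity : Integrable (gaussDensity : Vec n → ℝ) := by
  have := Integrable.fintype_prod (μ := fun _ : Fin n => (volume : Measure ℝ))
    (f := fun _ y => gaussianPDFReal 0 1 y) (fun j => integrable_gaussianPDFReal 0 1)
  exact (PiLp.volume_preserving_ofLp (Fin n)).integrable_comp_of_integrable this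

lemma integral_sq_mul_gaussianPDFReal : ∫ y, y ^ 2 * gaussianPDFReal 0 1 y = 1 := by
  have h := variance_fun_id_gaussianReal (μ := 0) (v := 1)
  rw [variance_of_integral_eq_zero (by fun_prop) (by simp),
    integral_gaussianReal_eq_integral_smul one_ne_zero] at h
  simpa [mul_comm] using h

lemma abs_rpow_mul_exp_le {r : ℝ} (hr : 0 < r) (x : ℝ) :
    |x| ^ r ≤ (2 * r / Real.exp 1) ^ (r / 2) * Real.exp (x ^ 2 / 4) := by
  have h1 : x ^ 2 ≤ 2 * r / Real.exp 1 * Real.exp (x ^ 2 / (2 * r)) := by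
    have := Real.add_one_le_exp (x ^ 2 / (2 * r) - 1)
    rw [Real.exp_sub] at this
    have h2 : x ^ 2 = 2 * r * (x ^ 2 / (2 * r) - 1 + 1) := by field_simp; ring
    calc x ^ 2 = 2 * r * (x ^ 2 / (2 * r) - 1 + 1) := h2
      _ ≤ 2 * r * (Real.exp (x ^ 2 / (2 * r)) / Real.exp 1) := by gcongr
      _ = _ := by ring
  calc |x| ^ r = (x ^ 2) ^ (r / 2) := by
        rw [← sq_abs, ← Real.rpow_natCast, ← Real.rpow_mul (abs_nonneg x)]
        congr 1; push_cast; ring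
    _ ≤ (2 * r / Real.exp 1 * Real.exp (x ^ 2 / (2 * r))) ^ (r / 2) := by gcongr
    _ = _ := by
        rw [Real.mul_rpow (by positivity) (by positivity), ← Real.exp_mul]
        congr 2; field_simp; ring

lemma abs_rpow_mul_gaussianPDFReal_le {r : ℝ} (hr : 0 < r) (x : ℝ) :
    |x| ^ r * gaussianPDFReal 0 1 x
      ≤ (2 * r / Real.exp 1) ^ (r / 2) * √2 * gaussianPDFReal 0 2 x := by
  have h : gaussianPDFReal 0 1 x = √2 * gaussianPDFReal 0 2 x * Real.exp (-(x ^ 2 / 4)) := by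
    simp only [gaussianPDFReal]
    have : √(2 * Real.pi * (2 : NNReal)) = √(2 * Real.pi) * √2 := by
      rw [← Real.sqrt_mul (by positivity)]; simp
    rw [this, mul_inv, mul_assoc, mul_assoc, mul_assoc, ← Real.exp_add]
    have h2 : √2 ≠ 0 := by positivity
    field_simp
    simp
    ring_nf
  have h3 := abs_rpow_mul_exp_le hr x
  have h4 : |x| ^ r * Real.exp (-(x ^ 2 / 4)) ≤ (2 * r / Real.exp 1) ^ (r / 2) := by
    calc _ ≤ (2 * r / Real.exp 1) ^ (r / 2) * Real.exp (x ^ 2 / 4) * Real.exp (-(x ^ 2 / 4)) := by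
          gcongr
      _ = _ := by rw [mul_assoc, ← Real.exp_add]; simp
  have := gaussianPDFReal_nonneg 0 2 x
  calc _ = (|x| ^ r * Real.exp (-(x ^ 2 / 4))) * (√2 * gaussianPDFReal 0 2 x) := by rw [h]; ring
    _ ≤ (2 * r / Real.exp 1) ^ (r / 2) * (√2 * gaussianPDFReal 0 2 x) := by gcongr
    _ = _ := by ring

lemma integrable_abs_rpow_mul_gaussianPDFReal {r : ℝ} (hr : 0 < r) :
    Integrable fun x => |x| ^ r * gaussianPDFReal 0 1 x := by
  refine Integrable.mono' ((integrable_gaussianPDFReal 0 2).const_mul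
    ((2 * r / Real.exp 1) ^ (r / 2) * √2)) ?_ (ae_of_all _ fun x => ?_)
  · have := measurable_gaussianPDFReal 0 1
    exact Measurable.aestronglyMeasurable (by fun_prop)
  · rw [Real.norm_of_nonneg (mul_nonneg (by positivity) (gaussianPDFReal_nonneg _ _ _))]
    exact abs_rpow_mul_gaussianPDFReal_le hr x

lemma integral_abs_rpow_mul_gaussianPDFReal_le {r : ℝ} (hr : 0 < r) :
    ∫ x, |x| ^ r * gaussianPDFReal 0 1 x ≤ (2 * r / Real.exp 1) ^ (r / 2) * √2 := by
  refine (integral_mono (integrable_abs_rpow_mul_gaussianPDFReal hr)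
    ((integrable_gaussianPDFReal 0 2).const_mul _)
    (abs_rpow_mul_gaussianPDFReal_le hr)).trans_eq ?_
  rw [integral_const_mul, integral_gaussianPDFReal_eq_one 0 two_ne_zero, mul_one]

lemma lpNorm_nonneg (p : ℝ) (x : Vec n) : 0 ≤ lpNorm p x := by
  unfold lpNorm; positivity

lemma lpNorm_smul {p : ℝ} (hp : 0 < p) (c : ℝ) (x : Vec n) :
    lpNorm p (c • x) = |c| * lpNorm p x := by
  simp only [lpNorm, PiLp.smul_apply, smul_eq_mul, abs_mul]
  simp_rw [Real.mul_rpow (abs_nonneg _) (abs_nonneg _), ← Finset.mul_sum]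
  rw [Real.mul_rpow (by positivity) (by positivity), ← Real.rpow_mul (abs_nonneg c),
    mul_one_div_cancel hp.ne', Real.rpow_one]

lemma lpNorm_two (x : Vec n) : lpNorm 2 x = ‖x‖ := by
  rw [lpNorm, EuclideanSpace.norm_eq, Real.sqrt_eq_rpow]
  congr 2
  ext i
  simp

lemma lpNorm_sq_eq {p : ℝ} (x : Vec n) : lpNorm p x ^ 2 = (∑ i, |x i| ^ p) ^ (2 / p) := by
  rw [lpNorm, ← Real.rpow_natCast, ← Real.rpow_mul (by positivity)]
  congr 1
  push_cast; ring

lemma continuous_lpNorm {p : ℝ} (hp : 0 < p) : Continuous (lpNorm p : Vec n → ℝ) := by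
  unfold lpNorm
  refine Continuous.rpow_const (continuous_finsetSum _ fun i _ => ?_) fun x => Or.inr (by positivity)
  exact Continuous.rpow_const (by fun_prop) fun x => Or.inr hp.le

lemma integral_norm_sq_mul_gaussDensity : ∫ x : Vec n, ‖x‖ ^ 2 * gaussDensity x = n := by
  have h : ∀ x : Vec n, ‖x‖ ^ 2 * gaussDensity x = ∑ i, (x i) ^ 2 * gaussDensity x := by
    intro x; simp [EuclideanSpace.norm_sq_eq, Finset.sum_mul]
  simp_rw [h]
  rw [integral_finsetSum]
  · simp [integral_coord_gaussDensity _ fun y => y ^ 2, integral_sq_mul_gaussianPDFReal]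
  · intro i _
    refine integrable_coord_gaussDensity i (f := fun y => y ^ 2) ?_
    simpa using integrable_abs_rpow_mul_gaussianPDFReal two_pos

/-- Integrals of `2`-homogeneous functions over the sphere are Gaussian integrals. -/
lemma integral_homogeneous_mul_gaussDensity [NeZero n] {φ : Vec n → ℝ}
    (hφ : ∀ (r : ℝ) (x : Vec n), 0 < r → φ (r • x) = r ^ 2 * φ x) :
    ∫ x, φ x * gaussDensity x = n * ∫ e, φ e ∂(sphereUniform n) := by
  obtain ⟨K, hK⟩ := exists_integral_homogeneous n
  have h1 := hK (fun x => ‖x‖ ^ 2) fun r x hr => by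
    rw [norm_smul, mul_pow, Real.norm_of_nonneg hr.le]
  rw [integral_norm_sq_mul_gaussDensity, integral_congr_ae (g := fun _ => (1 : ℝ))
    (by filter_upwards [ae_norm_eq_one_sphereUniform] with e he; simp [he])] at h1
  simp only [integral_const, probReal_univ, smul_eq_mul, mul_one] at h1
  rw [hK φ hφ, h1]

lemma integral_sphereUniform_comp_isometry [NeZero n] (A : Vec n ≃ₗᵢ[ℝ] Vec n) (h : Vec n → ℝ) :
    ∫ e, h (A e) ∂(sphereUniform n) = ∫ e, h e ∂(sphereUniform n) := by
  have key : ∀ h : Vec n → ℝ, ∫ x, (‖x‖ ^ 2 * h (‖x‖⁻¹ • x)) * gaussDensity x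
      = n * ∫ e, h e ∂(sphereUniform n) := by
    intro h
    rw [integral_homogeneous_mul_gaussDensity]
    · congr 1
      refine integral_congr_ae ?_
      filter_upwards [ae_norm_eq_one_sphereUniform] with e he
      simp [he]
    · intro r x hr
      have : (‖r • x‖)⁻¹ • (r • x) = ‖x‖⁻¹ • x := by
        rw [norm_smul, Real.norm_of_nonneg hr.le, smul_smul]
        congr 1; field_simp
      rw [this, norm_smul, Real.norm_of_nonneg hr.le]; ring
  have h1 := key h
  have h2 := key (fun e => h (A e))
  rw [← A.measurePreserving.integral_comp A.toHomeomorph.measurableEmbedding] at h1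
  have hn : (n : ℝ) ≠ 0 := NeZero.ne _
  refine mul_left_cancel₀ hn (h2.symm.trans (Eq.trans ?_ h1))
  congr 1
  ext x
  simp [gaussDensity_eq]

/-- A function on `ℝⁿ` that is invariant under permutations and sign changes of coordinates. -/
def IsSymmetricFn (φ : Vec n → ℝ) : Prop :=
  ∀ (x y : Vec n) (π : Equiv.Perm (Fin n)), (∀ i, |y i| = |x (π i)|) → φ y = φ x

lemma isSymmetricFn_lpNorm_sq (p : ℝ) : IsSymmetricFn fun x : Vec n => lpNorm p x ^ 2 := by
  intro x y π h
  simp only [lpNorm, h]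
  rw [Equiv.sum_comp π fun i => |x i| ^ p]

lemma integral_coord_mul_coord_of_ne [NeZero n] {φ : Vec n → ℝ} (hφ : IsSymmetricFn φ)
    {i j : Fin n} (hij : i ≠ j) : ∫ e, e i * e j * φ e ∂(sphereUniform n) = 0 := by
  have h := integral_sphereUniform_comp_isometry (LinearIsometryEquiv.piLpCongrRight 2
    fun k : Fin n => if k = i then LinearIsometryEquiv.neg ℝ (E := ℝ)
      else LinearIsometryEquiv.refl ℝ ℝ) (fun e => e i * e j * φ e)
  have h2 : ∀ e : Vec n, φ (LinearIsometryEquiv.piLpCongrRight 2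
    (fun k : Fin n => if k = i then LinearIsometryEquiv.neg ℝ (E := ℝ)
      else LinearIsometryEquiv.refl ℝ ℝ) e) = φ e := by
    intro e
    refine hφ _ _ (Equiv.refl _) fun k => ?_
    by_cases hk : k = i <;> simp [hk]
  simp only [h2] at h
  simp [hij.symm] at h
  rw [integral_neg] at h
  linarith

lemma integrable_sphereUniform_of_continuous [NeZero n] {φ : Vec n → ℝ} (hφ : Continuous φ) :
    Integrable φ (sphereUniform n) := by
  obtain ⟨C, hC⟩ := (isCompact_sphere (0 : Vec n) 1).exists_bound_of_continuousOn hφ.continuousOn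
  refine Integrable.mono' (integrable_const C) hφ.aestronglyMeasurable ?_
  filter_upwards [ae_norm_eq_one_sphereUniform] with e he
  exact hC e (by simpa using he)

lemma integral_coord_sq [NeZero n] {φ : Vec n → ℝ} (hφ : IsSymmetricFn φ) (hφc : Continuous φ)
    (i : Fin n) : ∫ e, e i * e i * φ e ∂(sphereUniform n)
      = (∫ e, φ e ∂(sphereUniform n)) / n := by
  have h1 : ∀ j, ∫ e, e j * e j * φ e ∂(sphereUniform n)
      = ∫ e, e i * e i * φ e ∂(sphereUniform n) := by
    intro j
    rw [← integral_sphereUniform_comp_isometry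
      (LinearIsometryEquiv.piLpCongrLeft 2 ℝ ℝ (Equiv.swap i j)) fun e => e i * e i * φ e]
    have h2 : ∀ e : Vec n, φ (LinearIsometryEquiv.piLpCongrLeft 2 ℝ ℝ (Equiv.swap i j) e) = φ e :=
      fun e => hφ _ _ (Equiv.swap i j) fun k => by
        simp [LinearIsometryEquiv.piLpCongrLeft_apply, Equiv.piCongrLeft', Equiv.symm_swap]
    simp only [h2]
    simp [LinearIsometryEquiv.piLpCongrLeft_apply, Equiv.piCongrLeft']
  have h3 : ∫ e, φ e ∂(sphereUniform n) = ∑ j, ∫ e, e j * e j * φ e ∂(sphereUniform n) := by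
    rw [← integral_finsetSum _ fun j _ => integrable_sphereUniform_of_continuous (by fun_prop)]
    refine integral_congr_ae ?_
    filter_upwards [ae_norm_eq_one_sphereUniform] with e he
    rw [← Finset.sum_mul]
    have : ∑ j, e j * e j = 1 := by
      have := EuclideanSpace.norm_sq_eq e
      rw [he] at this
      simp only [Real.norm_eq_abs, sq_abs] at this
      simp only [← sq]
      linarith
    rw [this, one_mul]
  rw [h3, Finset.sum_congr rfl fun j _ => h1 j]
  have hn : (n : ℝ) ≠ 0 := NeZero.ne _
  simp
  field_simp

lemma integral_coord_mul_coord [NeZero n] {φ : Vec n → ℝ} (hφ : IsSymmetricFn φ)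
    (hφc : Continuous φ) (i j : Fin n) : ∫ e, e i * e j * φ e ∂(sphereUniform n)
      = if i = j then (∫ e, φ e ∂(sphereUniform n)) / n else 0 := by
  split_ifs with h
  · subst h; exact integral_coord_sq hφ hφc i
  · exact integral_coord_mul_coord_of_ne hφ h

lemma rpow_two_div_le_tangent {r A S : ℝ} (hr : 2 ≤ r) (hA : 0 < A) (hS : 0 ≤ S) :
    S ^ (2 / r) ≤ A ^ (2 / r) * (2 / r * (S / A) + (1 - 2 / r)) := by
  have h1 : 2 / r ≤ 1 := by rw [div_le_one (by linarith)]; exact hr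
  have h := Real.geom_mean_le_arith_mean2_weighted (w₁ := 2 / r) (w₂ := 1 - 2 / r)
    (p₁ := S / A) (p₂ := 1) (by positivity) (by linarith) (by positivity) zero_le_one (by ring)
  rw [Real.one_rpow, mul_one, mul_one, Real.div_rpow hS hA.le, div_le_iff₀ (by positivity)] at h
  linarith

/-- The second moment of the `ℓ_r` norm on the Euclidean sphere. -/
lemma integral_lpNorm_sq_le [NeZero n] {r : ℝ} (hr : 2 ≤ r) :
    ∫ e, lpNorm r e ^ 2 ∂(sphereUniform n)
      ≤ 4 * √2 / Real.exp 1 * (r - 1) * (n : ℝ) ^ (2 / r - 1) := by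
  have hr0 : 0 < r := by linarith
  have hn : 0 < (n : ℝ) := Nat.cast_pos.2 (NeZero.pos n)
  set B : ℝ := (2 * r / Real.exp 1) ^ (r / 2) * √2 with hB
  have hBpos : 0 < B := by positivity
  have h1 := integral_homogeneous_mul_gaussDensity (n := n) (φ := fun x => lpNorm r x ^ 2)
    fun c x hc => by rw [lpNorm_smul hr0, mul_pow, sq_abs]
  have hInt : ∀ i : Fin n, Integrable fun x : Vec n => |x i| ^ r * gaussDensity x := fun i =>
    integrable_coord_gaussDensity i (f := fun y => |y| ^ r)
      (integrable_abs_rpow_mul_gaussianPDFReal hr0)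
  have hpos : ∀ x : Vec n, 0 ≤ gaussDensity x := fun x => by rw [gaussDensity_eq]; positivity
  have hS : ∫ x : Vec n, (∑ i, |x i| ^ r) * gaussDensity x ≤ n * B := by
    simp_rw [Finset.sum_mul]
    rw [integral_finsetSum _ fun i _ => hInt i]
    calc _ ≤ ∑ i : Fin n, B := Finset.sum_le_sum fun i _ => by
          rw [integral_coord_gaussDensity i fun y => |y| ^ r]
          exact integral_abs_rpow_mul_gaussianPDFReal_le hr0
      _ = _ := by simp
  have h2 : ∫ x : Vec n, lpNorm r x ^ 2 * gaussDensity x ≤ (n * B) ^ (2 / r) := by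
    have hInt2 : Integrable fun x : Vec n => (∑ i, |x i| ^ r) * gaussDensity x := by
      simp_rw [Finset.sum_mul]
      exact integrable_finsetSum _ fun i _ => hInt i
    calc _ ≤ ∫ x : Vec n, ((n * B) ^ (2 / r) * (2 / r / (n * B))) *
          ((∑ i, |x i| ^ r) * gaussDensity x)
          + (n * B) ^ (2 / r) * (1 - 2 / r) * gaussDensity x := by
          refine integral_mono_of_nonneg (ae_of_all _ fun x => mul_nonneg (sq_nonneg _) (hpos x))
            ((hInt2.const_mul _).add (integrable_gaussDensity.const_mul _))
            (ae_of_all _ fun x => ?_)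
          have := rpow_two_div_le_tangent (r := r) (A := n * B) (S := ∑ i, |x i| ^ r)
            hr (by positivity) (by positivity)
          calc _ ≤ _ := mul_le_mul_of_nonneg_right ((lpNorm_sq_eq x).trans_le this) (hpos x)
            _ = _ := by ring
      _ = (n * B) ^ (2 / r) * (2 / r / (n * B)) * (∫ x : Vec n, (∑ i, |x i| ^ r) * gaussDensity x)
          + (n * B) ^ (2 / r) * (1 - 2 / r) := by
          rw [integral_add (hInt2.const_mul _) (integrable_gaussDensity.const_mul _),
            integral_const_mul, integral_const_mul, integral_gaussDensity, mul_one]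
      _ ≤ (n * B) ^ (2 / r) * (2 / r / (n * B)) * (n * B) + (n * B) ^ (2 / r) * (1 - 2 / r) := by
          gcongr
      _ = _ := by field_simp; ring
  have h3 : B ^ (2 / r) ≤ 4 * √2 / Real.exp 1 * (r - 1) := by
    have e1 : ((2 * r / Real.exp 1) ^ (r / 2)) ^ (2 / r) = 2 * r / Real.exp 1 := by
      rw [← Real.rpow_mul (by positivity)]
      have : r / 2 * (2 / r) = 1 := by field_simp
      rw [this, Real.rpow_one]
    have e2 : √2 ^ (2 / r) ≤ √2 := by
      conv_rhs => rw [← Real.rpow_one √2]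
      refine Real.rpow_le_rpow_of_exponent_le (Real.one_le_sqrt.2 one_le_two) ?_
      rw [div_le_one hr0]; exact hr
    rw [hB, Real.mul_rpow (by positivity) (by positivity), e1]
    calc _ ≤ 2 * r / Real.exp 1 * √2 := by gcongr
      _ = 2 * √2 / Real.exp 1 * r := by ring
      _ ≤ 2 * √2 / Real.exp 1 * (2 * (r - 1)) := by gcongr; linarith
      _ = _ := by ring
  have h4 : (n : ℝ) ^ (2 / r) = n * (n : ℝ) ^ (2 / r - 1) := by
    rw [Real.rpow_sub hn, Real.rpow_one]; field_simp
  rw [h1, Real.mul_rpow hn.le hBpos.le, h4] at h2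
  have h5 : 0 ≤ (n : ℝ) ^ (2 / r - 1) := by positivity
  nlinarith [mul_le_mul_of_nonneg_left h3 (mul_nonneg hn.le h5)]

end Sphere

section Norms

variable {n : ℕ}

lemma lpNorm_anti {a b : ℝ} (ha : 0 < a) (hab : a ≤ b) (x : Vec n) : lpNorm b x ≤ lpNorm a x := by
  have hb : 0 < b := ha.trans_le hab
  set N := lpNorm a x with hN
  have hN0 : 0 ≤ N := lpNorm_nonneg a x
  have hpow : N ^ a = ∑ i, |x i| ^ a := by
    rw [hN, lpNorm, ← Real.rpow_mul (by positivity), one_div_mul_cancel ha.ne', Real.rpow_one]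
  have hi : ∀ i, |x i| ≤ N := by
    intro i
    rw [← Real.rpow_le_rpow_iff (abs_nonneg _) hN0 ha, hpow]
    exact Finset.single_le_sum (f := fun i => |x i| ^ a) (fun j _ => by positivity)
      (Finset.mem_univ i)
  have hsum : ∑ i, |x i| ^ b ≤ N ^ b := by
    calc ∑ i, |x i| ^ b = ∑ i, |x i| ^ a * |x i| ^ (b - a) := by
          refine Finset.sum_congr rfl fun i _ => ?_
          rw [← Real.rpow_add_of_nonneg (abs_nonneg _) ha.le (by linarith)]; congr 1; ring
      _ ≤ ∑ i, |x i| ^ a * N ^ (b - a) := by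
          refine Finset.sum_le_sum fun i _ => ?_
          gcongr
          exact hi i
      _ = N ^ b := by
          rw [← Finset.sum_mul, ← hpow, ← Real.rpow_add_of_nonneg hN0 ha.le (by linarith)]
          congr 1; ring
  calc lpNorm b x = (∑ i, |x i| ^ b) ^ (1 / b) := rfl
    _ ≤ (N ^ b) ^ (1 / b) := by gcongr
    _ = N := by rw [← Real.rpow_mul hN0, mul_one_div_cancel hb.ne', Real.rpow_one]

lemma norm_le_lpNorm {p : ℝ} (h1 : 1 ≤ p) (h2 : p ≤ 2) (x : Vec n) : ‖x‖ ≤ lpNorm p x := by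
  rw [← lpNorm_two]
  exact lpNorm_anti (by linarith) h2 x

lemma inner_le_lpNorm_mul_lpNorm {r p : ℝ} (hp : 0 < p) (hr : 1 < r) (hpr : p ≤ r / (r - 1))
    (x y : Vec n) : inner ℝ x y ≤ lpNorm r x * lpNorm p y := by
  have hc : r.HolderConjugate (r / (r - 1)) := Real.HolderConjugate.conjExponent hr
  calc inner ℝ x y = ∑ i, x i * y i := by
        simp [PiLp.inner_apply, mul_comm]
    _ ≤ lpNorm r x * lpNorm (r / (r - 1)) y := Real.inner_le_Lp_mul_Lq _ _ _ hc
    _ ≤ _ := mul_le_mul_of_nonneg_left (lpNorm_anti hp hpr y) (lpNorm_nonneg _ _)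

end Norms

section Exponents

variable {n : ℕ} {p : ℝ}

lemma two_lt_log (hn : 8 ≤ n) : 2 < Real.log n := by
  have h1 : Real.log 8 = 3 * Real.log 2 := by
    rw [show (8 : ℝ) = 2 ^ 3 by norm_num, Real.log_pow]; norm_num
  have h2 : Real.log 8 ≤ Real.log n := Real.log_le_log (by norm_num) (by exact_mod_cast hn)
  linarith [Real.log_two_gt_d9]

/-- The exponent `min {q, 2 ln n}`, where `1 / p + 1 / q = 1`. -/
def dualExp (p : ℝ) (n : ℕ) : ℝ :=
  if p = 1 then 2 * Real.log n else min (p / (p - 1)) (2 * Real.log n)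

lemma two_le_dualExp (hn : 8 ≤ n) (h1 : 1 ≤ p) (h2 : p ≤ 2) : 2 ≤ dualExp p n := by
  have hl := two_lt_log hn
  unfold dualExp
  split_ifs with h
  · linarith
  · have : 0 < p - 1 := by
      rcases h1.lt_or_eq with h' | h'
      · linarith
      · exact absurd h'.symm h
    refine le_min ?_ (by linarith)
    rw [le_div_iff₀ this]; linarith

lemma le_conjExponent_dualExp (hn : 8 ≤ n) (h1 : 1 ≤ p) (h2 : p ≤ 2) :
    p ≤ dualExp p n / (dualExp p n - 1) := by
  have hr := two_le_dualExp hn h1 h2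
  rw [le_div_iff₀ (by linarith)]
  by_cases h : p = 1
  · subst h; linarith
  · have hp : 0 < p - 1 := by
      rcases h1.lt_or_eq with h' | h'
      · linarith
      · exact absurd h'.symm h
    have : dualExp p n ≤ p / (p - 1) := by
      unfold dualExp
      rw [if_neg h]; exact min_le_left _ _
    rw [le_div_iff₀ hp] at this
    linarith

lemma one_le_card_mul_rho (hn : 8 ≤ n) (h1 : 1 ≤ p) (h2 : p ≤ 2) : 1 ≤ n * rho p n := by
  have hl := two_lt_log hn
  have hn1 : (1 : ℝ) ≤ n := by exact_mod_cast (by omega : 1 ≤ n)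
  have hn0 : (0 : ℝ) < n := by linarith
  have e : (n : ℝ) ^ (2 * (1 - 1 / p) - 1) * n = (n : ℝ) ^ (2 * (1 - 1 / p)) := by
    rw [Real.rpow_sub hn0, Real.rpow_one]; field_simp
  have h3 : 1 ≤ (n : ℝ) ^ (2 * (1 - 1 / p)) := by
    refine Real.one_le_rpow hn1 ?_
    have : 1 / p ≤ 1 := by rw [div_le_one (by linarith)]; exact h1
    linarith
  have h4 : 1 ≤ (if p = 1 then 16 * Real.log n - 8
      else min (p / (p - 1) - 1) (16 * Real.log n - 8)) := by
    split_ifs with h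
    · linarith
    · have hp : 0 < p - 1 := by
        rcases h1.lt_or_eq with h' | h'
        · linarith
        · exact absurd h'.symm h
      refine le_min ?_ (by linarith)
      rw [le_sub_iff_add_le, le_div_iff₀ hp]; linarith
  unfold rho
  rw [mul_comm, mul_assoc, e]
  exact one_le_mul_of_one_le_of_one_le h4 h3

lemma rho_pos (hn : 8 ≤ n) (h1 : 1 ≤ p) (h2 : p ≤ 2) : 0 < rho p n := by
  have := one_le_card_mul_rho hn h1 h2
  have hn0 : (0 : ℝ) < n := by exact_mod_cast (by omega : 0 < n)
  by_contra! h
  nlinarith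

lemma card_mul_rho_one_le (hn : 8 ≤ n) : n * rho 1 n ≤ 16 * Real.log n := by
  have hn0 : (0 : ℝ) < n := by exact_mod_cast (by omega : 0 < n)
  have : (n : ℝ) * rho 1 n = 16 * Real.log n - 8 := by
    simp [rho, Real.rpow_neg_one]; field_simp
  linarith

/-- The second moment of the dual norm of a random direction. -/
lemma integral_lpNorm_dualExp_sq_le (hn : 8 ≤ n) (h1 : 1 ≤ p) (h2 : p ≤ 2) :
    ∫ e, lpNorm (dualExp p n) e ^ 2 ∂(sphereUniform n) ≤ 6 * rho p n := by
  have : NeZero n := ⟨by omega⟩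
  have hl := two_lt_log hn
  have hn1 : (1 : ℝ) ≤ n := by exact_mod_cast (by omega : 1 ≤ n)
  have hn0 : (0 : ℝ) < n := by linarith
  have hr := two_le_dualExp hn h1 h2
  refine (integral_lpNorm_sq_le hr).trans ?_
  have hs : √2 ≤ 3 / 2 := by rw [Real.sqrt_le_left (by norm_num)]; norm_num
  have he : 2 ≤ Real.exp 1 := by linarith [Real.add_one_le_exp (1 : ℝ)]
  have he4 : 4 * √2 / Real.exp 1 ≤ 6 := by
    rw [div_le_iff₀ (by positivity)]; linarith
  by_cases hA : p ≠ 1 ∧ p / (p - 1) ≤ 2 * Real.log n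
  · have hp : 0 < p - 1 := by
      rcases h1.lt_or_eq with h' | h'
      · linarith
      · exact absurd h'.symm hA.1
    have hq : dualExp p n = p / (p - 1) := by
      rw [dualExp, if_neg hA.1, min_eq_left hA.2]
    have hrho : rho p n = (dualExp p n - 1) * (n : ℝ) ^ (2 / dualExp p n - 1) := by
      rw [rho, if_neg hA.1, hq, min_eq_left (by linarith [hA.2])]
      congr 2
      field_simp
    rw [hrho, mul_assoc]
    have : 0 ≤ dualExp p n - 1 := by linarith
    gcongr
  · have hq : dualExp p n = 2 * Real.log n := by
      unfold dualExp
      split_ifs with h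
      · rfl
      · rw [min_eq_right]
        by_contra! h'
        exact hA ⟨h, h'.le⟩
    have e1 : (n : ℝ) ^ (2 / dualExp p n - 1) = Real.exp 1 / n := by
      rw [Real.rpow_sub hn0, Real.rpow_one, hq]
      congr 1
      rw [Real.rpow_def_of_pos hn0]
      congr 1
      field_simp
    have h3 : 2 * Real.log n - 1 ≤ (if p = 1 then 16 * Real.log n - 8
      else min (p / (p - 1) - 1) (16 * Real.log n - 8)) := by
      split_ifs with h
      · linarith
      · refine le_min ?_ (by linarith)
        by_contra! h'
        exact hA ⟨h, by linarith⟩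
    have h4 : (n : ℝ)⁻¹ ≤ (n : ℝ) ^ (2 * (1 - 1 / p) - 1) := by
      rw [← Real.rpow_neg_one]
      refine Real.rpow_le_rpow_of_exponent_le hn1 ?_
      have : 1 / p ≤ 1 := by rw [div_le_one (by linarith)]; exact h1
      linarith
    have h5 : (2 * Real.log n - 1) * (n : ℝ)⁻¹ ≤ rho p n := by
      unfold rho
      refine mul_le_mul h3 h4 (by positivity) (le_trans (by linarith) h3)
    rw [e1, hq]
    calc 4 * √2 / Real.exp 1 * (2 * Real.log n - 1) * (Real.exp 1 / n)
        = 4 * √2 * ((2 * Real.log n - 1) * (n : ℝ)⁻¹) := by field_simp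
      _ ≤ 6 * ((2 * Real.log n - 1) * (n : ℝ)⁻¹) := by
          have : 0 ≤ (2 * Real.log n - 1) * (n : ℝ)⁻¹ :=
            mul_nonneg (by linarith) (by positivity)
          gcongr
          linarith
      _ ≤ _ := by gcongr

end Exponents

section Prox

variable {n : ℕ}

lemma inner_gradient (f : Vec n → ℝ) (x v : Vec n) :
    inner ℝ (gradient f x) v = fderiv ℝ f x v := by
  rw [gradient, InnerProductSpace.toDual_symm_apply]

lemma differentiable_lpNorm_sq {κ : ℝ} (h1 : 1 < κ) (h2 : κ ≤ 2) :
    Differentiable ℝ fun x : Vec n => lpNorm κ x ^ 2 := by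
  simp_rw [lpNorm_sq_eq]
  intro x
  refine DifferentiableAt.rpow_const ?_ (Or.inr ?_)
  · refine DifferentiableAt.fun_sum fun i _ => ?_
    have := (hasDerivAt_abs_rpow (x i) h1).differentiableAt
    exact this.comp x (f := fun x : Vec n => x i) (by fun_prop)
  · rw [le_div_iff₀ (by linarith)]; linarith

/-- The sum of the `κ`-th powers of `√(uᵢ² + δ²)`. -/
def smoothedSum (κ δ : ℝ) (u : Vec n) : ℝ := ∑ i, (u i ^ 2 + δ ^ 2) ^ (κ / 2)

lemma lpNorm_sq_le_smoothed {κ δ : ℝ} (h1 : 1 < κ) (h2 : κ < 2) (hδ : 0 < δ) (u v : Vec n) :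
    lpNorm κ v ^ 2 ≤ smoothedSum κ δ u ^ (2 / κ - 1) *
      ∑ i, (u i ^ 2 + δ ^ 2) ^ (κ / 2 - 1) * v i ^ 2 := by
  have hκ : 0 < κ := by linarith
  have hA : ∀ i, 0 < u i ^ 2 + δ ^ 2 := fun i => by positivity
  set T := ∑ i, (u i ^ 2 + δ ^ 2) ^ (κ / 2 - 1) * v i ^ 2 with hT
  have hT0 : 0 ≤ T := Finset.sum_nonneg fun i _ => by have := hA i; positivity
  have hS0 : 0 ≤ smoothedSum κ δ u := Finset.sum_nonneg fun i _ => by have := hA i; positivity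
  have hc : (2 / κ).HolderConjugate (2 / (2 - κ)) := by
    rw [Real.holderConjugate_iff]
    constructor
    · rw [lt_div_iff₀ hκ]; linarith
    · have : 2 - κ ≠ 0 := by linarith
      field_simp; ring
  have h := Real.inner_le_Lp_mul_Lq_of_nonneg Finset.univ hc
    (f := fun i => ((u i ^ 2 + δ ^ 2) ^ (κ / 2 - 1) * v i ^ 2) ^ (κ / 2))
    (g := fun i => ((u i ^ 2 + δ ^ 2) ^ (κ / 2)) ^ (1 - κ / 2))
    (fun i _ => by have := hA i; positivity) (fun i _ => by have := hA i; positivity)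
  have e1 : ∀ i, ((u i ^ 2 + δ ^ 2) ^ (κ / 2 - 1) * v i ^ 2) ^ (κ / 2) *
      ((u i ^ 2 + δ ^ 2) ^ (κ / 2)) ^ (1 - κ / 2) = |v i| ^ κ := by
    intro i
    have := hA i
    rw [Real.mul_rpow (by positivity) (by positivity), ← Real.rpow_mul this.le,
      ← Real.rpow_mul this.le, mul_right_comm, ← Real.rpow_add this]
    have e : (κ / 2 - 1) * (κ / 2) + κ / 2 * (1 - κ / 2) = 0 := by ring
    rw [e, Real.rpow_zero, one_mul, ← sq_abs, ← Real.rpow_natCast, ← Real.rpow_mul (abs_nonneg _)]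
    congr 1; push_cast; ring
  have e2 : ∀ i, (((u i ^ 2 + δ ^ 2) ^ (κ / 2 - 1) * v i ^ 2) ^ (κ / 2)) ^ (2 / κ)
      = (u i ^ 2 + δ ^ 2) ^ (κ / 2 - 1) * v i ^ 2 := by
    intro i
    have := hA i
    rw [← Real.rpow_mul (by positivity)]
    have e : κ / 2 * (2 / κ) = 1 := by field_simp
    rw [e, Real.rpow_one]
  have e3 : ∀ i, (((u i ^ 2 + δ ^ 2) ^ (κ / 2)) ^ (1 - κ / 2)) ^ (2 / (2 - κ))
      = (u i ^ 2 + δ ^ 2) ^ (κ / 2) := by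
    intro i
    have := hA i
    rw [← Real.rpow_mul (by positivity)]
    have e : (1 - κ / 2) * (2 / (2 - κ)) = 1 := by
      have : 2 - κ ≠ 0 := by linarith
      field_simp
    rw [e, Real.rpow_one]
  simp only [e1, e2, e3] at h
  change _ ≤ T ^ _ * smoothedSum κ δ u ^ _ at h
  rw [lpNorm_sq_eq]
  calc _ ≤ (T ^ (1 / (2 / κ)) * smoothedSum κ δ u ^ (1 / (2 / (2 - κ)))) ^ (2 / κ) := by gcongr
    _ = _ := by
      rw [Real.mul_rpow (by positivity) (by positivity), ← Real.rpow_mul hT0,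
        ← Real.rpow_mul hS0]
      have e : 1 / (2 / κ) * (2 / κ) = 1 := by field_simp
      have e' : 1 / (2 / (2 - κ)) * (2 / κ) = 2 / κ - 1 := by field_simp
      rw [e, e', Real.rpow_one, mul_comm]

lemma convexOn_smoothed {κ δ : ℝ} (h1 : 1 < κ) (h2 : κ < 2) (hδ : 0 < δ) (x v : Vec n)
    (hn : 0 < n) : ConvexOn ℝ Set.univ fun s : ℝ =>
      1 / 2 * smoothedSum κ δ (x + s • v) ^ (2 / κ) - (κ - 1) * lpNorm κ v ^ 2 * (s ^ 2 / 2) := by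
  have hκ : 0 < κ := by linarith
  set A : Fin n → ℝ → ℝ := fun i s => (x i + s * v i) ^ 2 + δ ^ 2 with hAdef
  have hA : ∀ i s, 0 < A i s := fun i s => by positivity
  have hdA : ∀ i s, HasDerivAt (A i) (2 * (x i + s * v i) * v i) s := by
    intro i s
    have := ((((hasDerivAt_id s).mul_const (v i)).const_add (x i)).pow 2).add_const (δ ^ 2)
    convert! this using 1
    simp
  have hne : Nonempty (Fin n) := ⟨⟨0, hn⟩⟩
  set S : ℝ → ℝ := fun s => ∑ i, A i s ^ (κ / 2) with hSdef
  have hSeq : ∀ s, smoothedSum κ δ (x + s • v) = S s := fun s => by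
    simp [smoothedSum, hSdef, hAdef]
  have hS : ∀ s, 0 < S s := fun s =>
    Finset.sum_pos (fun i _ => Real.rpow_pos_of_pos (hA i s) _) Finset.univ_nonempty
  set S1 : ℝ → ℝ := fun s => ∑ i, κ * (A i s ^ (κ / 2 - 1) * ((x i + s * v i) * v i)) with hS1
  set S2 : ℝ → ℝ := fun s => ∑ i, κ * (A i s ^ (κ / 2 - 1) * v i ^ 2
    + (κ - 2) * (A i s ^ (κ / 2 - 2) * (x i + s * v i) ^ 2) * v i ^ 2) with hS2
  have hdS : ∀ s, HasDerivAt S (S1 s) s := by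
    intro s
    refine HasDerivAt.fun_sum fun i _ => ?_
    convert! (hdA i s).rpow_const (p := κ / 2) (Or.inl (hA i s).ne') using 1
    ring
  have hdS1 : ∀ s, HasDerivAt S1 (S2 s) s := by
    intro s
    refine HasDerivAt.fun_sum fun i _ => ?_
    have ha := (hdA i s).rpow_const (p := κ / 2 - 1) (Or.inl (hA i s).ne')
    have hb := (((hasDerivAt_id s).mul_const (v i)).const_add (x i)).mul_const (v i)
    convert! (ha.mul hb).const_mul κ using 1
    rw [show κ / 2 - 1 - 1 = κ / 2 - 2 by ring]
    simp only [id]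
    ring
  set c := (κ - 1) * lpNorm κ v ^ 2 with hc
  simp only [hSeq]
  refine convexOn_of_hasDerivWithinAt2_nonneg convex_univ
    (f' := fun s => 1 / κ * (S s ^ (2 / κ - 1) * S1 s) - c * s)
    (f'' := fun s => 1 / κ * ((2 / κ - 1) * S s ^ (2 / κ - 2) * S1 s ^ 2 + S s ^ (2 / κ - 1) * S2 s)
      - c) ?_ ?_ ?_ ?_
  · refine continuousOn_of_forall_continuousAt fun s _ => ?_
    have := (hdS s).continuousAt
    exact ((this.rpow_const (Or.inl (hS s).ne')).const_mul _).sub (by fun_prop)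
  · intro s _
    refine HasDerivAt.hasDerivWithinAt ?_
    have ha := ((hdS s).rpow_const (p := 2 / κ) (Or.inl (hS s).ne')).const_mul (1 / 2)
    have hb := (((hasDerivAt_id s).pow 2).div_const 2).const_mul c
    convert! ha.sub hb using 1
    simp
    field_simp
  · intro s _
    refine HasDerivAt.hasDerivWithinAt ?_
    have ha := (((hdS s).rpow_const (p := 2 / κ - 1) (Or.inl (hS s).ne')).mul (hdS1 s)).const_mul
      (1 / κ)
    have hb := (hasDerivAt_id s).const_mul c
    convert! ha.sub hb using 1
    rw [show 2 / κ - 1 - 1 = 2 / κ - 2 by ring]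
    ring
  · intro s _
    have hT := lpNorm_sq_le_smoothed h1 h2 hδ (x + s • v) v
    rw [hSeq] at hT
    set T := ∑ i, A i s ^ (κ / 2 - 1) * v i ^ 2 with hTdef
    have hT' : lpNorm κ v ^ 2 ≤ S s ^ (2 / κ - 1) * T := by
      simpa [hTdef, hAdef] using hT
    have hS2le : κ * (κ - 1) * T ≤ S2 s := by
      rw [hTdef, hS2, Finset.mul_sum]
      refine Finset.sum_le_sum fun i _ => ?_
      have h3 : A i s ^ (κ / 2 - 2) * (x i + s * v i) ^ 2 ≤ A i s ^ (κ / 2 - 1) := by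
        have : A i s ^ (κ / 2 - 1) = A i s ^ (κ / 2 - 2) * A i s := by
          rw [← Real.rpow_add_one (hA i s).ne']; congr 1; ring
        rw [this]
        have := Real.rpow_nonneg (hA i s).le (κ / 2 - 2)
        gcongr
        simp only [hAdef]
        nlinarith
      have h4 : (κ - 1) * (A i s ^ (κ / 2 - 1) * v i ^ 2) ≤ A i s ^ (κ / 2 - 1) * v i ^ 2
          + (κ - 2) * (A i s ^ (κ / 2 - 2) * (x i + s * v i) ^ 2) * v i ^ 2 := by
        nlinarith [mul_le_mul_of_nonneg_right h3 (mul_nonneg (by linarith : 0 ≤ 2 - κ)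
          (sq_nonneg (v i)))]
      rw [mul_assoc]
      exact mul_le_mul_of_nonneg_left h4 hκ.le
    have hp : 0 ≤ 2 / κ - 1 := by rw [sub_nonneg, le_div_iff₀ hκ]; linarith
    have hSp := Real.rpow_nonneg (hS s).le (2 / κ - 1)
    have h5 : 0 ≤ (2 / κ - 1) * S s ^ (2 / κ - 2) * S1 s ^ 2 := by
      have := (hS s).le
      positivity
    have h6 : c ≤ 1 / κ * (S s ^ (2 / κ - 1) * S2 s) := by
      calc c ≤ (κ - 1) * (S s ^ (2 / κ - 1) * T) := by
            rw [hc]; exact mul_le_mul_of_nonneg_left hT' (by linarith)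
        _ = 1 / κ * (S s ^ (2 / κ - 1) * (κ * (κ - 1) * T)) := by field_simp
        _ ≤ _ := by gcongr
    have h7 : 0 ≤ 1 / κ * ((2 / κ - 1) * S s ^ (2 / κ - 2) * S1 s ^ 2) := by positivity
    linarith

lemma tendsto_smoothedSum {κ : ℝ} (hκ : 0 < κ) (u : Vec n) :
    Filter.Tendsto (fun δ => 1 / 2 * smoothedSum κ δ u ^ (2 / κ)) (nhdsWithin 0 (Set.Ioi 0))
      (nhds (1 / 2 * lpNorm κ u ^ 2)) := by
  have hcont : Continuous fun δ => 1 / 2 * smoothedSum κ δ u ^ (2 / κ) := by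
    unfold smoothedSum
    refine continuous_const.mul (Continuous.rpow_const (continuous_finsetSum _ fun i _ => ?_)
      fun δ => Or.inr (by positivity))
    exact Continuous.rpow_const (by fun_prop) fun δ => Or.inr (by positivity)
  have h0 : 1 / 2 * smoothedSum κ 0 u ^ (2 / κ) = 1 / 2 * lpNorm κ u ^ 2 := by
    rw [lpNorm_sq_eq, smoothedSum]
    congr 3
    ext i
    rw [← sq_abs, ← Real.rpow_natCast |u i|]
    simp only [ne_eq, OfNat.ofNat_ne_zero, not_false_eq_true, zero_pow, add_zero]
    rw [← Real.rpow_mul (abs_nonneg _)]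
    congr 1; push_cast; ring
  rw [← h0]
  exact (hcont.tendsto 0).mono_left nhdsWithin_le_nhds

lemma convexOn_half_lpNorm_sq_sub {κ : ℝ} (h1 : 1 < κ) (h2 : κ < 2) (x v : Vec n)
    (hn : 0 < n) : ConvexOn ℝ Set.univ fun s : ℝ =>
      1 / 2 * lpNorm κ (x + s • v) ^ 2 - (κ - 1) * lpNorm κ v ^ 2 * (s ^ 2 / 2) := by
  refine ⟨convex_univ, fun s _ t _ a b ha hb hab => ?_⟩
  have hκ : 0 < κ := by linarith
  have lim : ∀ s : ℝ, Filter.Tendsto (fun δ => 1 / 2 * smoothedSum κ δ (x + s • v) ^ (2 / κ)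
      - (κ - 1) * lpNorm κ v ^ 2 * (s ^ 2 / 2)) (nhdsWithin 0 (Set.Ioi 0))
      (nhds (1 / 2 * lpNorm κ (x + s • v) ^ 2 - (κ - 1) * lpNorm κ v ^ 2 * (s ^ 2 / 2))) :=
    fun s => (tendsto_smoothedSum hκ _).sub_const _
  refine le_of_tendsto_of_tendsto (lim _) (((lim s).const_smul a).add ((lim t).const_smul b)) ?_
  filter_upwards [self_mem_nhdsWithin] with δ hδ
  exact (convexOn_smoothed h1 h2 hδ x v hn).2 trivial trivial ha hb hab

/-- `½ ‖·‖_κ²` is `(κ - 1)`-strongly convex with respect to `‖·‖_κ`. -/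
lemma half_lpNorm_sq_strongly_convex {κ : ℝ} (h1 : 1 < κ) (h2 : κ < 2) (hn : 0 < n)
    (x y : Vec n) : (κ - 1) / 2 * lpNorm κ (y - x) ^ 2 ≤ 1 / 2 * lpNorm κ y ^ 2
      - 1 / 2 * lpNorm κ x ^ 2 - fderiv ℝ (fun x : Vec n => 1 / 2 * lpNorm κ x ^ 2) x (y - x) := by
  set v := y - x with hv
  have hconv := convexOn_half_lpNorm_sq_sub h1 h2 x v hn
  have hd : DifferentiableAt ℝ (fun x : Vec n => 1 / 2 * lpNorm κ x ^ 2) (x + (0 : ℝ) • v) :=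
    (differentiable_lpNorm_sq h1 h2.le).const_mul _ _
  have hl : HasDerivAt (fun s : ℝ => x + s • v) v 0 := by
    simpa using ((hasDerivAt_id (0 : ℝ)).smul_const v).const_add x
  have hder := hd.hasFDerivAt.comp_hasDerivAt (0 : ℝ) hl
  have hder2 := hder.sub (((((hasDerivAt_id (0 : ℝ)).pow 2).div_const 2).const_mul
    ((κ - 1) * lpNorm κ v ^ 2)))
  have h3 := hconv.le_slope_of_hasDerivAt trivial trivial zero_lt_one hder2
  simp [slope_def_field] at h3
  have e : x + v = y := by rw [hv]; abel
  rw [e] at h3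
  simp only [one_div]
  linarith

lemma lpNorm_one_sq_le {κ : ℝ} (h1 : 1 < κ) (x : Vec n) :
    lpNorm 1 x ^ 2 ≤ (n : ℝ) ^ (2 * (κ - 1) / κ) * lpNorm κ x ^ 2 := by
  have hc : κ.HolderConjugate (κ / (κ - 1)) := Real.HolderConjugate.conjExponent h1
  have h := Real.inner_le_Lp_mul_Lq Finset.univ (fun i => |x i|) (fun _ => 1) hc
  simp only [mul_one, abs_abs, abs_one, Real.one_rpow, Finset.sum_const, Finset.card_univ,
    Fintype.card_fin, nsmul_eq_mul] at h
  have h' : lpNorm 1 x ≤ lpNorm κ x * (n : ℝ) ^ (1 / (κ / (κ - 1))) := by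
    simpa [lpNorm] using h
  calc lpNorm 1 x ^ 2 ≤ (lpNorm κ x * (n : ℝ) ^ (1 / (κ / (κ - 1)))) ^ 2 := by
        have := lpNorm_nonneg 1 x
        gcongr
    _ = _ := by
        rw [mul_pow, mul_comm, ← Real.rpow_natCast ((n : ℝ) ^ _), ← Real.rpow_mul (by positivity)]
        congr 2
        push_cast
        field_simp

lemma isProxFunction_proxOne (hn : 8 ≤ n) : IsProxFunction 1 (proxOne n) := by
  have hl := two_lt_log hn
  have hn0 : (0 : ℝ) < n := by exact_mod_cast (by omega : 0 < n)
  set κ := kappa n with hκ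
  have hκ1 : κ - 1 = 1 / Real.log n := by rw [hκ, kappa]; ring
  have h1 : 1 < κ := by have : 0 < 1 / Real.log n := by positivity
                        linarith
  have h2 : κ < 2 := by
    have : 1 / Real.log n < 1 := by rw [div_lt_one (by linarith)]; linarith
    linarith
  set A := Real.exp 1 * (n : ℝ) ^ ((κ - 1) * (2 - κ) / κ) * Real.log n with hA
  have hfun : proxOne n = fun x : Vec n => A * (1 / 2 * lpNorm κ x ^ 2) := by
    ext x; rw [proxOne, hA]; ring
  have hdiff : Differentiable ℝ fun x : Vec n => 1 / 2 * lpNorm κ x ^ 2 :=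
    (differentiable_lpNorm_sq h1 h2.le).const_mul _
  have hA0 : 0 ≤ A := by
    have : 0 ≤ Real.log n := by linarith
    positivity
  refine ⟨?_, fun x y => ?_⟩
  · rw [hfun]; exact hdiff.const_mul A
  · rw [inner_gradient, hfun, fderiv_const_mul (hdiff x)]
    have h3 := mul_le_mul_of_nonneg_left (half_lpNorm_sq_strongly_convex h1 h2 (by omega) x y) hA0
    have h4 := lpNorm_one_sq_le h1 (y - x)
    have h5 : A * (κ - 1) = (n : ℝ) ^ (2 * (κ - 1) / κ) := by
      have e1 : Real.exp 1 = (n : ℝ) ^ (κ - 1) := by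
        rw [hκ1, Real.rpow_def_of_pos hn0]; congr 1; field_simp
      rw [hA, hκ1, mul_assoc, mul_one_div_cancel (by linarith), mul_one, ← hκ1, e1,
        ← Real.rpow_add hn0]
      congr 1
      field_simp; ring
    rw [← h5] at h4
    simp only [smul_apply, smul_eq_mul]
    linarith

lemma isProxFunction_proxTwo (n : ℕ) : IsProxFunction 2 (proxTwo n) := by
  have hd : ∀ x : Vec n, HasFDerivAt (proxTwo n) (innerSL ℝ x) x := by
    intro x
    have := (hasStrictFDerivAt_norm_sq x).hasFDerivAt.const_mul (1 / 2)
    convert! this using 1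
    ext v; simp
  refine ⟨fun x => (hd x).differentiableAt, fun x y => ?_⟩
  rw [inner_gradient, (hd x).fderiv, lpNorm_two, innerSL_apply_apply, proxTwo, proxTwo,
    norm_sub_sq_real, inner_sub_right, real_inner_self_eq_norm_sq, real_inner_comm x y]
  linarith

end Prox

section MirrorStep

variable {n : ℕ} {p : ℝ} {d : Vec n → ℝ}

lemma half_lpNorm_sq_le_bregman (hd : IsProxFunction p d) (z x : Vec n) :
    1 / 2 * lpNorm p (x - z) ^ 2 ≤ bregman d z x := hd.strongly_convex z x

lemma bregman_nonneg (hd : IsProxFunction p d) (z x : Vec n) : 0 ≤ bregman d z x :=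
  le_trans (by positivity) (half_lpNorm_sq_le_bregman hd z x)

lemma half_norm_sq_le_bregman (hd : IsProxFunction p d) (h1 : 1 ≤ p) (h2 : p ≤ 2) (z x : Vec n) :
    1 / 2 * ‖x - z‖ ^ 2 ≤ bregman d z x := by
  refine le_trans ?_ (half_lpNorm_sq_le_bregman hd z x)
  have := norm_le_lpNorm h1 h2 (x - z)
  gcongr

lemma norm_sub_le_norm_gradient_sub (hd : IsProxFunction p d) (h1 : 1 ≤ p) (h2 : p ≤ 2)
    (x y : Vec n) : ‖x - y‖ ≤ ‖gradient d x - gradient d y‖ := by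
  have a := half_norm_sq_le_bregman hd h1 h2 x y
  have b := half_norm_sq_le_bregman hd h1 h2 y x
  have e : bregman d x y + bregman d y x = inner ℝ (gradient d x - gradient d y) (x - y) := by
    simp only [bregman, inner_sub_left, inner_sub_right]; ring
  have c := real_inner_le_norm (gradient d x - gradient d y) (x - y)
  rw [norm_sub_rev] at a
  rcases (norm_nonneg (x - y)).eq_or_lt with h | h
  · rw [← h]; positivity
  · refine le_of_mul_le_mul_right (a := ‖x - y‖) ?_ h
    nlinarith

lemma gradient_injective (hd : IsProxFunction p d) (h1 : 1 ≤ p) (h2 : p ≤ 2) :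
    Function.Injective (gradient d) := by
  intro x y h
  have := norm_sub_le_norm_gradient_sub hd h1 h2 x y
  rw [h, sub_self, norm_zero] at this
  exact sub_eq_zero.1 (norm_le_zero_iff.1 this)

lemma exists_minimizer (hd : IsProxFunction p d) (h1 : 1 ≤ p) (h2 : p ≤ 2) (w : Vec n) :
    ∃ x, ∀ y, d x - inner ℝ w x ≤ d y - inner ℝ w y := by
  have hc : Continuous fun x => d x - inner ℝ w x := by
    have := hd.differentiable.continuous
    fun_prop
  refine hc.exists_forall_le ?_
  have hlow : ∀ y, d 0 + ‖y‖ * (1 / 2 * ‖y‖ - ‖gradient d 0 - w‖) ≤ d y - inner ℝ w y := by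
    intro y
    have a := half_norm_sq_le_bregman hd h1 h2 0 y
    have b := abs_le.1 (abs_real_inner_le_norm (gradient d 0 - w) y)
    simp only [bregman, sub_zero] at a
    rw [inner_sub_left] at b
    nlinarith [b.1]
  refine Filter.tendsto_atTop_mono hlow ?_
  refine Filter.tendsto_atTop_add_const_left _ _ ?_
  have hn : Filter.Tendsto (fun y : Vec n => ‖y‖) (Filter.cocompact _) Filter.atTop :=
    tendsto_norm_cocompact_atTop
  refine hn.atTop_mul_atTop₀ ?_
  exact Filter.tendsto_atTop_add_const_right _ _ (hn.const_mul_atTop (by norm_num))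

/-- The inverse of the gradient of a prox-function. -/
def mirrorInv (d : Vec n → ℝ) (w : Vec n) : Vec n := argminPt fun u => d u - inner ℝ w u

lemma gradient_eq_of_minimizer (hd : Differentiable ℝ d) {w x : Vec n}
    (h : ∀ y, d x - inner ℝ w x ≤ d y - inner ℝ w y) : gradient d x = w := by
  have hmin : IsLocalMin (fun u => d u - inner ℝ w u) x := Filter.Eventually.of_forall h
  have hder : HasFDerivAt (fun u => d u - inner ℝ w u) (fderiv ℝ d x - innerSL ℝ w) x :=
    (hd x).hasFDerivAt.sub (innerSL ℝ w).hasFDerivAt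
  have h0 := hmin.hasFDerivAt_eq_zero hder
  refine ext_inner_right ℝ fun v => ?_
  rw [inner_gradient]
  have := congrArg (fun A : Vec n →L[ℝ] ℝ => A v) h0
  simp at this
  linarith

lemma gradient_mirrorInv (hd : IsProxFunction p d) (h1 : 1 ≤ p) (h2 : p ≤ 2) (w : Vec n) :
    gradient d (mirrorInv d w) = w :=
  gradient_eq_of_minimizer hd.differentiable (Classical.epsilon_spec (exists_minimizer hd h1 h2 w))

lemma continuous_mirrorInv (hd : IsProxFunction p d) (h1 : 1 ≤ p) (h2 : p ≤ 2) :
    Continuous (mirrorInv d) := by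
  refine (LipschitzWith.of_dist_le_mul (K := 1) fun w w' => ?_).continuous
  have := norm_sub_le_norm_gradient_sub hd h1 h2 (mirrorInv d w) (mirrorInv d w')
  rw [gradient_mirrorInv hd h1 h2, gradient_mirrorInv hd h1 h2] at this
  simpa [dist_eq_norm] using this

lemma argminPt_eq_mirrorInv (hd : IsProxFunction p d) (h1 : 1 ≤ p) (h2 : p ≤ 2) (z a : Vec n) :
    (argminPt fun u => inner ℝ a (u - z) + bregman d z u) = mirrorInv d (gradient d z - a) := by
  have e : ∀ u, inner ℝ a (u - z) + bregman d z u = (d u - inner ℝ (gradient d z - a) u)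
      + (inner ℝ (gradient d z - a) z - d z) := by
    intro u
    simp only [bregman, inner_sub_left, inner_sub_right]; ring
  have hex : ∃ x, ∀ y, inner ℝ a (x - z) + bregman d z x ≤ inner ℝ a (y - z) + bregman d z y := by
    obtain ⟨x, hx⟩ := exists_minimizer hd h1 h2 (gradient d z - a)
    exact ⟨x, fun y => by rw [e, e]; exact add_le_add_left (hx y) _⟩
  have hspec := Classical.epsilon_spec hex
  refine gradient_injective hd h1 h2 ?_
  rw [gradient_mirrorInv hd h1 h2]
  refine gradient_eq_of_minimizer hd.differentiable fun y => ?_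
  have := hspec y
  rw [e, e] at this
  exact le_of_add_le_add_right this

lemma measurable_gradient (d : Vec n → ℝ) : Measurable (gradient d) :=
  (InnerProductSpace.toDual ℝ (Vec n)).symm.continuous.measurable.comp (measurable_fderiv ℝ d)

lemma measurable_bregman (hd : IsProxFunction p d) (u : Vec n) :
    Measurable fun z => bregman d z u := by
  have h1 := measurable_gradient d
  have h2 := hd.differentiable.continuous.measurable
  unfold bregman
  fun_prop

/-- The basic inequality of a mirror descent step. -/
lemma bregman_mirrorInv_le (hd : IsProxFunction p d) (h1 : 1 ≤ p) (h2 : p ≤ 2) (z a u : Vec n)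
    {R : ℝ} (hR : ∀ v, inner ℝ a v ≤ R * lpNorm p v) :
    bregman d (mirrorInv d (gradient d z - a)) u
      ≤ bregman d z u - inner ℝ a (z - u) + 1 / 2 * R ^ 2 := by
  set y := mirrorInv d (gradient d z - a) with hy
  have hg : gradient d y = gradient d z - a := gradient_mirrorInv hd h1 h2 _
  have h3 : bregman d z u - bregman d y u - bregman d z y = - inner ℝ a (u - y) := by
    simp only [bregman, hg, inner_sub_left, inner_sub_right]; ring
  have h5 := half_lpNorm_sq_le_bregman hd z y
  have h6 := hR (z - y)
  have e : lpNorm p (z - y) = lpNorm p (y - z) := by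
    simp [lpNorm, abs_sub_comm]
  rw [e] at h6
  have h7 : inner ℝ a (z - u) = inner ℝ a (z - y) - inner ℝ a (u - y) := by
    simp only [inner_sub_right]; ring
  nlinarith [sq_nonneg (R - lpNorm p (y - z))]

end MirrorStep

section Objective

variable {n : ℕ}

lemma inner_eq_sum (x y : Vec n) : inner ℝ x y = ∑ i, x i * y i := by
  simp [PiLp.inner_apply, mul_comm]

lemma inner_single (x : Vec n) (i : Fin n) : inner ℝ x (EuclideanSpace.single i 1) = x i := by
  rw [EuclideanSpace.inner_single_right]; simp

lemma abs_sub_sub_inner_gradient_le {φ : Vec n → ℝ} (hφ : Differentiable ℝ φ) {K : ℝ} (hK : 0 ≤ K)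
    (hlip : ∀ x y, ‖gradient φ x - gradient φ y‖ ≤ K * ‖x - y‖) (x y : Vec n) :
    |φ y - φ x - inner ℝ (gradient φ x) (y - x)| ≤ K * ‖y - x‖ ^ 2 := by
  have h := (convex_segment x y).norm_image_sub_le_of_norm_fderiv_le' (𝕜 := ℝ) (f := φ)
    (φ := fderiv ℝ φ x) (C := K * ‖y - x‖) (fun z _ => hφ z) (fun z hz => ?_)
    (left_mem_segment ℝ x y) (right_mem_segment ℝ x y)
  · rw [inner_gradient, ← Real.norm_eq_abs]
    calc _ ≤ _ := h
      _ = _ := by ring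
  · have e : ‖fderiv ℝ φ z - fderiv ℝ φ x‖ = ‖gradient φ z - gradient φ x‖ := by
      rw [gradient, gradient, ← map_sub, LinearIsometryEquiv.norm_map]
    rw [e]
    refine (hlip z x).trans ?_
    gcongr
    obtain ⟨a, b, ha, hb, hab, rfl⟩ := hz
    have : a • x + b • y - x = b • (y - x) := by
      rw [← eq_sub_iff_add_eq] at hab
      rw [hab]; module
    rw [this, norm_smul, Real.norm_of_nonneg hb]
    have : b ≤ 1 := by linarith
    nlinarith [norm_nonneg (y - x)]

lemma sub_le_inner_gradient_of_convexOn {φ : Vec n → ℝ} (hφ : Differentiable ℝ φ)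
    (hc : ConvexOn ℝ Set.univ φ) (x y : Vec n) :
    φ x - φ y ≤ inner ℝ (gradient φ x) (x - y) := by
  have hl : HasDerivAt (fun s : ℝ => x + s • (y - x)) (y - x) 0 := by
    simpa using ((hasDerivAt_id (0 : ℝ)).smul_const (y - x)).const_add x
  have hd : DifferentiableAt ℝ φ (x + (0 : ℝ) • (y - x)) := hφ _
  have hder := hd.hasFDerivAt.comp_hasDerivAt (0 : ℝ) hl
  have hconv : ConvexOn ℝ Set.univ (φ ∘ fun s : ℝ => x + s • (y - x)) := by
    have := hc.comp_affineMap (AffineMap.lineMap x y : ℝ →ᵃ[ℝ] Vec n)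
    refine (this.congr fun s _ => ?_)
    simp [AffineMap.lineMap_apply, add_comm]
  have h3 := hconv.le_slope_of_hasDerivAt trivial trivial zero_lt_one hder
  simp [slope_def_field] at h3
  rw [inner_gradient, map_sub]
  linarith

variable {𝒳 : Type*} [MeasurableSpace 𝒳] {P : Measure 𝒳}
  {F : Vec n → 𝒳 → ℝ} {L : 𝒳 → ℝ} {σ : ℝ}

lemma ae_lipConst_nonneg [NeZero n] (hF : IsSmoothStochasticProblem P F L σ) :
    ∀ᵐ ξ ∂P, 0 ≤ L ξ := by
  filter_upwards [hF.lipschitz] with ξ h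
  have := (norm_nonneg _).trans (h (EuclideanSpace.single 0 1) 0)
  simpa using this

lemma ae_quadratic_bound [NeZero n] (hF : IsSmoothStochasticProblem P F L σ) :
    ∀ᵐ ξ ∂P, ∀ x y, |F y ξ - F x ξ - inner ℝ (gradient (fun u => F u ξ) x) (y - x)|
      ≤ L ξ * ‖y - x‖ ^ 2 := by
  filter_upwards [ae_lipConst_nonneg hF, hF.differentiable, hF.lipschitz] with ξ h0 h1 h2 x y
  exact abs_sub_sub_inner_gradient_le h1 h0 h2 x y

lemma measurable_apply (hF : IsSmoothStochasticProblem P F L σ) (x : Vec n) : Measurable (F x) :=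
  hF.measurable.comp measurable_prodMk_left

lemma aestronglyMeasurable_partial (hF : IsSmoothStochasticProblem P F L σ) (x : Vec n)
    (i : Fin n) : AEStronglyMeasurable (fun ξ => gradient (fun u => F u ξ) x i) P := by
  refine aestronglyMeasurable_of_tendsto_ae (u := Filter.atTop)
    (f := fun (k : ℕ) ξ => ((k : ℝ) + 1) *
      (F (x + ((k : ℝ) + 1)⁻¹ • EuclideanSpace.single i 1) ξ - F x ξ)) (fun k => ?_) ?_
  · exact (((measurable_apply hF _).sub (measurable_apply hF _)).const_mul _).aestronglyMeasurable
  · filter_upwards [hF.differentiable] with ξ hξ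
    have e : gradient (fun u => F u ξ) x i
        = fderiv ℝ (fun u => F u ξ) x (EuclideanSpace.single i 1) := by
      rw [← inner_gradient, inner_single]
    rw [e]
    refine (hξ x).hasFDerivAt.lim (EuclideanSpace.single i 1) (c := fun k : ℕ => (k : ℝ) + 1) ?_
    refine Filter.tendsto_atTop_mono (fun k => le_abs_self _) ?_
    exact Filter.tendsto_atTop_add_const_right _ _ tendsto_natCast_atTop_atTop

lemma integral_sq_eq_smoothConst_sq : smoothConst P L ^ 2 = ∫ ξ, L ξ ^ 2 ∂P := by
  rw [smoothConst, Real.sq_sqrt (integral_nonneg fun _ => sq_nonneg _)]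

variable [IsProbabilityMeasure P]

lemma integrable_partial [NeZero n] (hF : IsSmoothStochasticProblem P F L σ) (x : Vec n)
    (i : Fin n) : Integrable (fun ξ => gradient (fun u => F u ξ) x i) P := by
  have hL : Integrable L P := hF.memLp.integrable one_le_two
  refine Integrable.mono' (((hF.integrable (x + EuclideanSpace.single i 1)).sub
    (hF.integrable x)).abs.add hL) (aestronglyMeasurable_partial hF x i) ?_
  filter_upwards [ae_quadratic_bound hF] with ξ h
  have := h x (x + EuclideanSpace.single i 1)
  rw [add_sub_cancel_left, inner_single, PiLp.norm_single, norm_one, one_pow, mul_one] at this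
  rw [Real.norm_eq_abs]
  simp only [Pi.add_apply, Pi.sub_apply]
  rw [abs_le] at this ⊢
  have h1 := neg_abs_le (F (x + EuclideanSpace.single i 1) ξ - F x ξ)
  have h2 := le_abs_self (F (x + EuclideanSpace.single i 1) ξ - F x ξ)
  constructor <;> linarith [this.1, this.2]

lemma integral_le_smoothConst (hL : MemLp L 2 P) : ∫ ξ, L ξ ∂P ≤ smoothConst P L := by
  refine Real.le_sqrt_of_sq_le ?_
  have := variance_nonneg L P
  rw [variance_eq_sub hL] at this
  simp only [Pi.pow_apply] at this
  linarith

/-- The vector of the expected partial derivatives. -/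
def meanGradient (P : Measure 𝒳) (F : Vec n → 𝒳 → ℝ) (x : Vec n) : Vec n :=
  WithLp.toLp 2 fun i => ∫ ξ, gradient (fun u => F u ξ) x i ∂P

lemma abs_objective_sub_le_aux [NeZero n] (hF : IsSmoothStochasticProblem P F L σ) (x y : Vec n) :
    |objective P F y - objective P F x - inner ℝ (meanGradient P F x) (y - x)|
      ≤ smoothConst P L * ‖y - x‖ ^ 2 := by
  have hL : Integrable L P := hF.memLp.integrable one_le_two
  have hInt : ∀ i, Integrable (fun ξ => gradient (fun u => F u ξ) x i * (y - x) i) P := fun i =>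
    (integrable_partial hF x i).mul_const _
  have e : inner ℝ (meanGradient P F x) (y - x)
      = ∫ ξ, inner ℝ (gradient (fun u => F u ξ) x) (y - x) ∂P := by
    simp_rw [inner_eq_sum]
    rw [integral_finsetSum _ fun i _ => hInt i]
    simp_rw [integral_mul_const]
    rfl
  have hInt2 : Integrable (fun ξ => inner ℝ (gradient (fun u => F u ξ) x) (y - x)) P := by
    have := integrable_finsetSum Finset.univ fun i _ => hInt i
    simpa only [inner_eq_sum] using this
  have hsub : Integrable (fun ξ => F y ξ - F x ξ) P := (hF.integrable y).sub (hF.integrable x)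
  rw [objective, objective, e, ← integral_sub (hF.integrable y) (hF.integrable x),
    ← integral_sub hsub hInt2]
  calc _ ≤ ∫ ξ, |F y ξ - F x ξ - inner ℝ (gradient (fun u => F u ξ) x) (y - x)| ∂P :=
        abs_integral_le_integral_abs
    _ ≤ ∫ ξ, L ξ * ‖y - x‖ ^ 2 ∂P := by
        refine integral_mono_ae (hsub.sub hInt2).abs
          (hL.mul_const _) ?_
        filter_upwards [ae_quadratic_bound hF] with ξ h using h x y
    _ ≤ _ := by
        rw [integral_mul_const]
        exact mul_le_mul_of_nonneg_right (integral_le_smoothConst hF.memLp) (sq_nonneg _)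

lemma hasFDerivAt_objective [NeZero n] (hF : IsSmoothStochasticProblem P F L σ) (x : Vec n) :
    HasFDerivAt (objective P F) (innerSL ℝ (meanGradient P F x)) x := by
  have h : (fun y => objective P F y - objective P F x - inner ℝ (meanGradient P F x) (y - x))
      =O[nhds x] fun y => ‖y - x‖ ^ 2 := by
    refine Asymptotics.IsBigO.of_bound (smoothConst P L) (Filter.Eventually.of_forall fun y => ?_)
    simpa using abs_objective_sub_le_aux hF x y
  have h0 := Asymptotics.IsBigO.hasFDerivAt (𝕜 := ℝ) h one_lt_two
  have h1 := ((innerSL ℝ (meanGradient P F x)).hasFDerivAt (x := x)).add h0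
  refine ((h1.add_const (objective P F x - inner ℝ (meanGradient P F x) x)).congr_of_eventuallyEq
    (Filter.Eventually.of_forall fun y => ?_)).congr_fderiv (by simp)
  simp only [Pi.add_apply, innerSL_apply_apply, inner_sub_right]
  ring

lemma gradient_objective [NeZero n] (hF : IsSmoothStochasticProblem P F L σ) (x : Vec n) :
    gradient (objective P F) x = meanGradient P F x := by
  refine ext_inner_right ℝ fun v => ?_
  rw [inner_gradient, (hasFDerivAt_objective hF x).fderiv, innerSL_apply_apply]

lemma differentiable_objective [NeZero n] (hF : IsSmoothStochasticProblem P F L σ) :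
    Differentiable ℝ (objective P F) := fun x => (hasFDerivAt_objective hF x).differentiableAt

lemma norm_gradient_objective_sq_le [NeZero n] (hF : IsSmoothStochasticProblem P F L σ)
    (hL : 0 < smoothConst P L) {xs : Vec n} (hxs : ∀ x, objective P F xs ≤ objective P F x)
    (x : Vec n) : ‖gradient (objective P F) x‖ ^ 2
      ≤ 4 * smoothConst P L * (objective P F x - objective P F xs) := by
  set K := smoothConst P L
  set g := gradient (objective P F) x with hg
  have h := (abs_le.1 (abs_objective_sub_le_aux hF x (x - (1 / (2 * K)) • g))).2
  rw [← gradient_objective hF, ← hg] at h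
  have e : x - (1 / (2 * K)) • g - x = -((1 / (2 * K)) • g) := by abel
  rw [e, norm_neg, norm_smul, inner_neg_right, inner_smul_right, real_inner_self_eq_norm_sq,
    Real.norm_of_nonneg (by positivity)] at h
  have h2 := hxs (x - (1 / (2 * K)) • g)
  have h3 : K * (1 / (2 * K) * ‖g‖) ^ 2 = ‖g‖ ^ 2 / (4 * K) := by field_simp; ring
  have h4 : 1 / (2 * K) * ‖g‖ ^ 2 = 2 * (‖g‖ ^ 2 / (4 * K)) := by field_simp; ring
  have h5 : ‖g‖ ^ 2 / (4 * K) ≤ objective P F x - objective P F xs := by linarith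
  rw [div_le_iff₀ (by positivity)] at h5
  linarith

lemma memLp_partial [NeZero n] (hF : IsSmoothStochasticProblem P F L σ) (x : Vec n) (i : Fin n) :
    MemLp (fun ξ => gradient (fun u => F u ξ) x i) 2 P := by
  have h : MemLp (fun ξ => gradient (fun u => F u ξ) x i - gradient (objective P F) x i) 2 P := by
    have hm : AEStronglyMeasurable
        (fun ξ => gradient (fun u => F u ξ) x i - gradient (objective P F) x i) P :=
      (aestronglyMeasurable_partial hF x i).sub aestronglyMeasurable_const
    rw [memLp_two_iff_integrable_sq hm]
    refine Integrable.mono' (hF.variance_integrable x) (hm.pow 2) (ae_of_all _ fun ξ => ?_)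
    rw [Real.norm_of_nonneg (sq_nonneg _), EuclideanSpace.norm_sq_eq]
    have := Finset.single_le_sum (f := fun j => ‖(gradient (fun u => F u ξ) x
      - gradient (objective P F) x) j‖ ^ 2) (fun j _ => sq_nonneg _) (Finset.mem_univ i)
    simpa using this
  have := h.add (memLp_const (gradient (objective P F) x i))
  refine this.ae_eq (ae_of_all _ fun ξ => by simp)

lemma sum_variance_partial_le [NeZero n] (hF : IsSmoothStochasticProblem P F L σ) (x : Vec n) :
    ∑ i, Var[fun ξ => gradient (fun u => F u ξ) x i; P] ≤ σ ^ 2 := by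
  refine le_trans (le_of_eq ?_) (hF.variance_le x)
  have hm : ∀ i, ∫ ξ, gradient (fun u => F u ξ) x i ∂P = gradient (objective P F) x i := fun i => by
    rw [gradient_objective hF, meanGradient]
  have e : ∀ ξ, ‖gradient (fun u => F u ξ) x - gradient (objective P F) x‖ ^ 2
      = ∑ i, (gradient (fun u => F u ξ) x i - gradient (objective P F) x i) ^ 2 := fun ξ => by
    simp [EuclideanSpace.norm_sq_eq]
  simp_rw [e]
  rw [integral_finsetSum]
  · refine Finset.sum_congr rfl fun i _ => ?_
    rw [variance_eq_integral (aestronglyMeasurable_partial hF x i).aemeasurable, hm]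
  · intro i _
    exact ((memLp_partial hF x i).sub (memLp_const _)).integrable_sq

end Objective

section Batch

variable {𝒳 : Type*} {n m : ℕ}

/-- The average of `h` over a batch. -/
def batchMean (h : 𝒳 → ℝ) (ξ : Fin m → 𝒳) : ℝ := 1 / (m : ℝ) * ∑ k, h (ξ k)

lemma gradEst_eq (fn : Vec n → 𝒳 → ℝ) (t : ℝ) (x e : Vec n) (ξ : Fin m → 𝒳) :
    gradEst fn t x e ξ = (batchMean (fun ζ => (fn (x + t • e) ζ - fn x ζ) / t) ξ • e, m) := by
  simp only [gradEst, oracleDiff, Prod.fst_sum, Prod.snd_sum, batchMean]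
  simp [← Finset.sum_smul, smul_smul]

variable [MeasurableSpace 𝒳] {P : Measure 𝒳} [IsProbabilityMeasure P]

lemma memLp_comp_eval {h : 𝒳 → ℝ} (hh : MemLp h 2 P) (k : Fin m) :
    MemLp (fun ξ : Fin m → 𝒳 => h (ξ k)) 2 (Measure.pi fun _ => P) :=
  hh.comp_measurePreserving (measurePreserving_eval (fun _ : Fin m => P) k)

lemma integrable_comp_eval {h : 𝒳 → ℝ} (hh : Integrable h P) (k : Fin m) :
    Integrable (fun ξ : Fin m → 𝒳 => h (ξ k)) (Measure.pi fun _ => P) :=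
  (measurePreserving_eval (fun _ : Fin m => P) k).integrable_comp_of_integrable hh

lemma integral_comp_eval {h : 𝒳 → ℝ} (hh : Integrable h P) (k : Fin m) :
    ∫ ξ : Fin m → 𝒳, h (ξ k) ∂(Measure.pi fun _ => P) = ∫ ζ, h ζ ∂P := by
  have hp := measurePreserving_eval (fun _ : Fin m => P) k
  conv_rhs => rw [← hp.map_eq]
  rw [integral_map hp.measurable.aemeasurable]
  rw [hp.map_eq]; exact hh.aestronglyMeasurable

lemma integrable_batchMean {h : 𝒳 → ℝ} (hh : Integrable h P) :
    Integrable (batchMean h) (Measure.pi fun _ : Fin m => P) :=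
  (integrable_finsetSum _ fun k _ => integrable_comp_eval hh k).const_mul _

lemma integral_batchMean [NeZero m] {h : 𝒳 → ℝ} (hh : Integrable h P) :
    ∫ ξ, batchMean h ξ ∂(Measure.pi fun _ : Fin m => P) = ∫ ζ, h ζ ∂P := by
  simp only [batchMean]
  rw [integral_const_mul, integral_finsetSum _ fun k _ => integrable_comp_eval hh k]
  simp_rw [integral_comp_eval hh]
  have : (m : ℝ) ≠ 0 := NeZero.ne _
  simp
  field_simp

lemma memLp_batchMean {h : 𝒳 → ℝ} (hh : MemLp h 2 P) :
    MemLp (batchMean h) 2 (Measure.pi fun _ : Fin m => P) :=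
  (memLp_finsetSum _ fun k _ => memLp_comp_eval hh k).const_mul _

lemma integral_batchMean_sq [NeZero m] {h : 𝒳 → ℝ} (hh : MemLp h 2 P) :
    ∫ ξ, batchMean h ξ ^ 2 ∂(Measure.pi fun _ : Fin m => P)
      = (∫ ζ, h ζ ∂P) ^ 2 + Var[h; P] / m := by
  have h1 := variance_eq_sub (memLp_batchMean (m := m) hh)
  rw [integral_batchMean (hh.integrable one_le_two)] at h1
  have h2 : Var[batchMean h; Measure.pi fun _ : Fin m => P] = Var[h; P] / m := by
    have e : (batchMean h : (Fin m → 𝒳) → ℝ)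
        = fun ξ => 1 / (m : ℝ) * (∑ k, fun ξ : Fin m → 𝒳 => h (ξ k)) ξ := by
      ext ξ; simp [batchMean]
    rw [e, variance_const_mul, variance_sum_pi fun _ => hh]
    have : (m : ℝ) ≠ 0 := NeZero.ne _
    simp
    field_simp
  rw [h2] at h1
  simp only [Pi.pow_apply] at h1
  linarith

end Batch

section QuadraticForm

variable {n : ℕ}

lemma inner_mul_inner_mul_eq (e u w : Vec n) (c : ℝ) :
    inner ℝ u e * inner ℝ w e * c = ∑ i, ∑ j, e i * e j * c * (u i * w j) := by
  rw [inner_eq_sum, inner_eq_sum, Finset.sum_mul_sum, Finset.sum_mul]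
  refine Finset.sum_congr rfl fun i _ => ?_
  rw [Finset.sum_mul]
  refine Finset.sum_congr rfl fun j _ => ?_
  ring

variable [NeZero n] {Y : Type*} [MeasurableSpace Y] {ν : Measure Y}

lemma integrable_quadratic {φ : Vec n → ℝ} (hφc : Continuous φ) {a : Fin n → Fin n → Y → ℝ}
    (ha : ∀ i j, Integrable (a i j) ν) :
    Integrable (fun z : Vec n × Y => ∑ i, ∑ j, z.1 i * z.1 j * φ z.1 * a i j z.2)
      ((sphereUniform n).prod ν) :=
  integrable_finsetSum _ fun i _ => integrable_finsetSum _ fun j _ =>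
    (integrable_sphereUniform_of_continuous (φ := fun e => e i * e j * φ e)
      (by fun_prop)).mul_prod (ha i j)

lemma integral_quadratic [SFinite ν] {φ : Vec n → ℝ} (hφ : IsSymmetricFn φ) (hφc : Continuous φ)
    {a : Fin n → Fin n → Y → ℝ} (ha : ∀ i j, Integrable (a i j) ν) :
    ∫ z : Vec n × Y, ∑ i, ∑ j, z.1 i * z.1 j * φ z.1 * a i j z.2 ∂((sphereUniform n).prod ν)
      = (∫ e, φ e ∂(sphereUniform n)) / n * ∑ i, ∫ y, a i i y ∂ν := by
  have hInt : ∀ i j, Integrable (fun z : Vec n × Y => z.1 i * z.1 j * φ z.1 * a i j z.2)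
      ((sphereUniform n).prod ν) := fun i j =>
    (integrable_sphereUniform_of_continuous (φ := fun e => e i * e j * φ e)
      (by fun_prop)).mul_prod (ha i j)
  rw [integral_finsetSum _ fun i _ => integrable_finsetSum _ fun j _ => hInt i j, Finset.mul_sum]
  refine Finset.sum_congr rfl fun i _ => ?_
  rw [integral_finsetSum _ fun j _ => hInt i j, Finset.sum_eq_single i]
  · rw [integral_prod_mul (fun e : Vec n => e i * e i * φ e) (a i i),
      integral_coord_mul_coord hφ hφc, if_pos rfl]
  · intro j _ hj
    rw [integral_prod_mul (fun e : Vec n => e i * e j * φ e) (a i j),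
      integral_coord_mul_coord hφ hφc, if_neg hj.symm, zero_mul]
  · simp

/-- Averaging a product of two linear forms over the sphere. -/
lemma integrable_inner_mul_inner {φ : Vec n → ℝ} (hφc : Continuous φ) {u w : Y → Vec n}
    (huw : ∀ i j, Integrable (fun y => u y i * w y j) ν) :
    Integrable (fun z : Vec n × Y => inner ℝ (u z.2) z.1 * inner ℝ (w z.2) z.1 * φ z.1)
      ((sphereUniform n).prod ν) := by
  simp_rw [inner_mul_inner_mul_eq]
  exact integrable_quadratic (a := fun i j y => u y i * w y j) hφc huw

lemma integral_inner_mul_inner [SFinite ν] {φ : Vec n → ℝ} (hφ : IsSymmetricFn φ) (hφc : Continuous φ)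
    {u w : Y → Vec n} (huw : ∀ i j, Integrable (fun y => u y i * w y j) ν) :
    ∫ z : Vec n × Y, inner ℝ (u z.2) z.1 * inner ℝ (w z.2) z.1 * φ z.1 ∂((sphereUniform n).prod ν)
      = (∫ e, φ e ∂(sphereUniform n)) / n * ∑ i, ∫ y, u y i * w y i ∂ν := by
  simp_rw [inner_mul_inner_mul_eq]
  exact integral_quadratic (a := fun i j y => u y i * w y j) hφ hφc huw

end QuadraticForm

section OneStep

variable {𝒳 : Type*} {n m : ℕ}

/-- The batch average of the stochastic gradients at `x`. -/
def batchGradient (F : Vec n → 𝒳 → ℝ) (x : Vec n) (ξ : Fin m → 𝒳) : Vec n :=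
  WithLp.toLp 2 fun i => batchMean (fun ζ => gradient (fun u => F u ζ) x i) ξ

/-- A bound for the squared error of the finite differences with step `t` and noise level `Δ`. -/
def diffErrorBound (L : 𝒳 → ℝ) (t Δ : ℝ) (ξ : Fin m → 𝒳) : ℝ :=
  2 * t ^ 2 * batchMean (fun ζ => L ζ ^ 2) ξ + 8 * Δ ^ 2 / t ^ 2

lemma inner_batchGradient (F : Vec n → 𝒳 → ℝ) (x e : Vec n) (ξ : Fin m → 𝒳) :
    inner ℝ (batchGradient F x ξ) e
      = batchMean (fun ζ => inner ℝ (gradient (fun u => F u ζ) x) e) ξ := by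
  simp only [inner_eq_sum, batchGradient, batchMean, mul_assoc, ← Finset.mul_sum, Finset.sum_mul]
  rw [Finset.sum_comm]

lemma batchMean_sq_le [NeZero m] (h : 𝒳 → ℝ) (ξ : Fin m → 𝒳) :
    batchMean h ξ ^ 2 ≤ batchMean (fun ζ => h ζ ^ 2) ξ := by
  have hm : (0 : ℝ) < m := Nat.cast_pos.2 (NeZero.pos m)
  have := sq_sum_le_card_mul_sum_sq (s := Finset.univ) (f := fun k => h (ξ k))
  simp only [Finset.card_univ, Fintype.card_fin] at this
  simp only [batchMean]
  rw [mul_pow]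
  calc _ ≤ (1 / (m : ℝ)) ^ 2 * (m * ∑ k, h (ξ k) ^ 2) := by gcongr
    _ = _ := by field_simp

lemma finiteDiff_error_le [NeZero m] {F η : Vec n → 𝒳 → ℝ} {L : 𝒳 → ℝ} {t Δ : ℝ} (ht : 0 < t)
    {x e : Vec n} {ξ : Fin m → 𝒳} (he : ‖e‖ = 1)
    (hF : ∀ k, |F (x + t • e) (ξ k) - F x (ξ k)
      - inner ℝ (gradient (fun u => F u (ξ k)) x) (x + t • e - x)| ≤ L (ξ k) * ‖x + t • e - x‖ ^ 2)
    (hη : ∀ k y, |η y (ξ k)| ≤ Δ) :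
    (batchMean (fun ζ => ((F (x + t • e) ζ + η (x + t • e) ζ) - (F x ζ + η x ζ)) / t) ξ
      - inner ℝ (batchGradient F x ξ) e) ^ 2 ≤ diffErrorBound L t Δ ξ := by
  have hm : (0 : ℝ) < m := Nat.cast_pos.2 (NeZero.pos m)
  set h : 𝒳 → ℝ := fun ζ => ((F (x + t • e) ζ + η (x + t • e) ζ) - (F x ζ + η x ζ)) / t
    - inner ℝ (gradient (fun u => F u ζ) x) e with hh
  have e1 : batchMean (fun ζ => ((F (x + t • e) ζ + η (x + t • e) ζ) - (F x ζ + η x ζ)) / t) ξ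
      - inner ℝ (batchGradient F x ξ) e = batchMean h ξ := by
    rw [inner_batchGradient]
    simp only [batchMean, hh, Finset.sum_sub_distrib]; ring
  rw [e1]
  refine (batchMean_sq_le h ξ).trans ?_
  have hk : ∀ k, h (ξ k) ^ 2 ≤ 2 * t ^ 2 * L (ξ k) ^ 2 + 8 * Δ ^ 2 / t ^ 2 := by
    intro k
    have h1 := hF k
    rw [add_sub_cancel_left, inner_smul_right, norm_smul, he, Real.norm_of_nonneg ht.le,
      mul_one] at h1
    have h2 := abs_le.1 (hη k (x + t • e))
    have h3 := abs_le.1 (hη k x)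
    have h4 := abs_le.1 h1
    have h5 : |t * h (ξ k)| ≤ L (ξ k) * t ^ 2 + 2 * Δ := by
      have : t * h (ξ k) = (F (x + t • e) (ξ k) - F x (ξ k)
          - t * inner ℝ (gradient (fun u => F u (ξ k)) x) e) + η (x + t • e) (ξ k) - η x (ξ k) := by
        simp only [hh]; field_simp; ring
      rw [this, abs_le]
      constructor <;> linarith [h2.1, h2.2, h3.1, h3.2, h4.1, h4.2]
    have h6 : (t * h (ξ k)) ^ 2 ≤ (L (ξ k) * t ^ 2 + 2 * Δ) ^ 2 := by
      rw [← sq_abs (t * h (ξ k))]; gcongr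
    have h7 : (L (ξ k) * t ^ 2 + 2 * Δ) ^ 2 ≤ 2 * (L (ξ k) * t ^ 2) ^ 2 + 2 * (2 * Δ) ^ 2 := by
      nlinarith [sq_nonneg (L (ξ k) * t ^ 2 - 2 * Δ)]
    have h8 : t ^ 2 * (2 * t ^ 2 * L (ξ k) ^ 2 + 8 * Δ ^ 2 / t ^ 2)
        = 2 * (L (ξ k) * t ^ 2) ^ 2 + 2 * (2 * Δ) ^ 2 := by field_simp; ring
    have ht2 : 0 < t ^ 2 := by positivity
    refine le_of_mul_le_mul_left ?_ ht2
    rw [h8, ← mul_pow]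
    linarith
  simp only [batchMean, diffErrorBound]
  calc _ ≤ 1 / (m : ℝ) * ∑ k, (2 * t ^ 2 * L (ξ k) ^ 2 + 8 * Δ ^ 2 / t ^ 2) := by
        gcongr with k _; exact hk k
    _ = _ := by
        rw [Finset.sum_add_distrib, ← Finset.mul_sum]
        simp
        field_simp

/-- An upper bound for the Bregman divergence after one step, in terms of the exact batch
gradient `g`, the error bound `Z`, the direction `e` and its dual norm `Q`. -/
def stepBound (n : ℕ) (α lam W : ℝ) (v g e : Vec n) (Z Q : ℝ) : ℝ :=
  W - α * n * (inner ℝ g e * inner ℝ v e * 1)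
    + α * n * (Z / (2 * lam) + lam / 2 * (inner ℝ v e * inner ℝ v e * 1))
    + α ^ 2 * n ^ 2 * (inner ℝ g e * inner ℝ g e * Q ^ 2 + Q ^ 2 * Z)

lemma bregman_step_le_stepBound {p : ℝ} {d : Vec n → ℝ} (hd : IsProxFunction p d) (hn : 8 ≤ n)
    (h1 : 1 ≤ p) (h2 : p ≤ 2) {α lam s Z : ℝ} (hα : 0 ≤ α) (hlam : 0 < lam) (x u g e : Vec n)
    (hs : (s - inner ℝ g e) ^ 2 ≤ Z) :
    bregman d (mirrorInv d (gradient d x - (α * n) • (s • e))) u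
      ≤ stepBound n α lam (bregman d x u) (x - u) g e Z (lpNorm (dualExp p n) e) := by
  set Q := lpNorm (dualExp p n) e with hQ
  have hr := two_le_dualExp hn h1 h2
  have hH : ∀ v, inner ℝ ((α * n) • (s • e)) v ≤ (α * n * |s| * Q) * lpNorm p v := by
    intro v
    have hc := inner_le_lpNorm_mul_lpNorm (by linarith) (by linarith)
      (le_conjExponent_dualExp hn h1 h2) ((α * n * s) • e) v
    rw [lpNorm_smul (by linarith), abs_mul, abs_of_nonneg (by positivity : 0 ≤ α * n)] at hc
    rwa [smul_smul]
  refine (bregman_mirrorInv_le hd h1 h2 x _ u hH).trans ?_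
  set a := inner ℝ g e
  set b := inner ℝ (x - u) e with hb
  have e1 : inner ℝ ((α * n) • (s • e)) (x - u) = α * n * (s * b) := by
    rw [inner_smul_left, inner_smul_left, hb, real_inner_comm]; simp
  rw [e1, stepBound]
  set ζ := s - a with hζ
  have hsζ : s = a + ζ := by rw [hζ]; ring
  have hy : -(ζ * b) ≤ Z / (2 * lam) + lam / 2 * (b * b) := by
    have : Z / (2 * lam) + lam / 2 * (b * b) + ζ * b
        = (Z - ζ ^ 2) / (2 * lam) + (ζ + lam * b) ^ 2 / (2 * lam) := by
      field_simp; ring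
    have h3 : 0 ≤ (Z - ζ ^ 2) / (2 * lam) := div_nonneg (by linarith) (by positivity)
    have h4 : 0 ≤ (ζ + lam * b) ^ 2 / (2 * lam) := by positivity
    linarith
  have hq : 1 / 2 * s ^ 2 ≤ a * a + Z := by rw [hsζ]; nlinarith [sq_nonneg (a - ζ)]
  have hαn : 0 ≤ α * n := by positivity
  have i1 := mul_le_mul_of_nonneg_left hy hαn
  have i2 := mul_le_mul_of_nonneg_left hq (by positivity : 0 ≤ (α * n) ^ 2 * Q ^ 2)
  have i3 : 1 / 2 * (α * n * |s| * Q) ^ 2 = (α * n) ^ 2 * Q ^ 2 * (1 / 2 * s ^ 2) := by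
    rw [← sq_abs s]; ring
  rw [i3]
  have i4 : α * n * (s * b) = α * n * (a * b) + α * n * (ζ * b) := by rw [hsζ]; ring
  rw [i4]
  linarith

variable [MeasurableSpace 𝒳] {P : Measure 𝒳} [IsProbabilityMeasure P]
  {F η : Vec n → 𝒳 → ℝ} {L : 𝒳 → ℝ} {σ : ℝ}

lemma integrable_diffErrorBound (hL : MemLp L 2 P) (t Δ : ℝ) :
    Integrable (diffErrorBound L t Δ) (Measure.pi fun _ : Fin m => P) :=
  ((integrable_batchMean hL.integrable_sq).const_mul _).add (integrable_const _)

lemma integral_diffErrorBound [NeZero m] (hL : MemLp L 2 P) {t Δ : ℝ} (hpos : 0 < smoothConst P L)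
    (hΔ : 0 < Δ) (ht : t = 2 * √(Δ / smoothConst P L)) :
    ∫ ξ, diffErrorBound L t Δ ξ ∂(Measure.pi fun _ : Fin m => P) = 10 * (Δ * smoothConst P L) := by
  have ht2 : t ^ 2 = 4 * (Δ / smoothConst P L) := by
    rw [ht, mul_pow, Real.sq_sqrt (by positivity)]; norm_num
  simp only [diffErrorBound]
  rw [integral_add ((integrable_batchMean hL.integrable_sq).const_mul _) (integrable_const _),
    integral_const_mul, integral_batchMean hL.integrable_sq, ← integral_sq_eq_smoothConst_sq]
  simp only [integral_const, probReal_univ, smul_eq_mul, one_mul]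
  rw [ht2]
  field_simp
  ring

lemma integral_norm_batchGradient_sq_le [NeZero n] [NeZero m]
    (hF : IsSmoothStochasticProblem P F L σ) (x : Vec n) :
    ∑ i, ∫ ξ, batchGradient F x ξ i * batchGradient F x ξ i ∂(Measure.pi fun _ : Fin m => P)
      ≤ ‖gradient (objective P F) x‖ ^ 2 + σ ^ 2 / m := by
  have h : ∀ i, ∫ ξ, batchGradient F x ξ i * batchGradient F x ξ i ∂(Measure.pi fun _ : Fin m => P)
      = gradient (objective P F) x i ^ 2 + Var[fun ζ => gradient (fun u => F u ζ) x i; P] / m := by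
    intro i
    have := integral_batchMean_sq (m := m) (memLp_partial hF x i)
    rw [gradient_objective hF]
    simpa [batchGradient, meanGradient, sq] using this
  simp_rw [h]
  rw [Finset.sum_add_distrib, ← Finset.sum_div, EuclideanSpace.norm_sq_eq]
  simp only [Real.norm_eq_abs, sq_abs]
  gcongr
  exact sum_variance_partial_le hF x

lemma ae_step_le [NeZero m] {p : ℝ} {d : Vec n → ℝ} (hd : IsProxFunction p d) (hn : 8 ≤ n)
    (h1 : 1 ≤ p) (h2 : p ≤ 2) (hF : IsSmoothStochasticProblem P F L σ) {Δ t α lam : ℝ}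
    (hη : IsBoundedNoise P η Δ) (ht : 0 < t) (hα : 0 ≤ α) (hlam : 0 < lam) (x u : Vec n) :
    ∀ᵐ z ∂((sphereUniform n).prod (Measure.pi fun _ : Fin m => P)),
      bregman d (mirrorInv d (gradient d x - (α * n) •
        (gradEst (fun x z => F x z + η x z) t x z.1 z.2).1)) u
      ≤ stepBound n α lam (bregman d x u) (x - u) (batchGradient F x z.2) z.1
        (diffErrorBound L t Δ z.2) (lpNorm (dualExp p n) z.1) := by
  have : NeZero n := ⟨by omega⟩
  have he : ∀ᵐ z ∂((sphereUniform n).prod (Measure.pi fun _ : Fin m => P)), ‖z.1‖ = 1 :=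
    Measure.quasiMeasurePreserving_fst.ae ae_norm_eq_one_sphereUniform
  have hk : ∀ᵐ z ∂((sphereUniform n).prod (Measure.pi fun _ : Fin m => P)), ∀ k,
      (∀ x y, |F y (z.2 k) - F x (z.2 k) - inner ℝ (gradient (fun u => F u (z.2 k)) x) (y - x)|
        ≤ L (z.2 k) * ‖y - x‖ ^ 2) ∧ ∀ y, |η y (z.2 k)| ≤ Δ := by
    rw [ae_all_iff]
    intro k
    refine Measure.quasiMeasurePreserving_snd.ae
      (p := fun ξ : Fin m → 𝒳 => (∀ x y, |F y (ξ k) - F x (ξ k)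
        - inner ℝ (gradient (fun u => F u (ξ k)) x) (y - x)|
        ≤ L (ξ k) * ‖y - x‖ ^ 2) ∧ ∀ y, |η y (ξ k)| ≤ Δ) ?_
    refine (measurePreserving_eval (fun _ : Fin m => P) k).quasiMeasurePreserving.ae
      (p := fun ζ => (∀ x y, |F y ζ - F x ζ
        - inner ℝ (gradient (fun u => F u ζ) x) (y - x)|
        ≤ L ζ * ‖y - x‖ ^ 2) ∧ ∀ y, |η y ζ| ≤ Δ) ?_
    filter_upwards [ae_quadratic_bound hF, hη.bound] with ζ h3 h4 using ⟨h3, h4⟩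
  filter_upwards [he, hk] with z hz1 hz2
  rw [gradEst_eq]
  exact bregman_step_le_stepBound hd hn h1 h2 hα hlam x u _ _
    (finiteDiff_error_le ht hz1 (fun k => (hz2 k).1 _ _) fun k => (hz2 k).2)

end OneStep

section Expectation

variable {𝒳 : Type*} {n m : ℕ} [MeasurableSpace 𝒳] {P : Measure 𝒳} [IsProbabilityMeasure P]
  {F η : Vec n → 𝒳 → ℝ} {L : 𝒳 → ℝ} {σ : ℝ}

lemma isSymmetricFn_const (c : ℝ) : IsSymmetricFn fun _ : Vec n => c := fun _ _ _ _ => rfl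

lemma integrable_integral_stepBound [NeZero n] [NeZero m] (hF : IsSmoothStochasticProblem P F L σ)
    {r : ℝ} (hr : 0 < r) (α lam W t Δ : ℝ) (v x : Vec n) :
    Integrable (fun z : Vec n × (Fin m → 𝒳) => stepBound n α lam W v (batchGradient F x z.2) z.1
        (diffErrorBound L t Δ z.2) (lpNorm r z.1))
      ((sphereUniform n).prod (Measure.pi fun _ : Fin m => P)) ∧
    ∫ z, stepBound n α lam W v (batchGradient F x z.2) z.1
        (diffErrorBound L t Δ z.2) (lpNorm r z.1)
      ∂((sphereUniform n).prod (Measure.pi fun _ : Fin m => P))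
      = W - α * inner ℝ (gradient (objective P F) x) v
        + α * n * ((∫ ξ, diffErrorBound L t Δ ξ ∂(Measure.pi fun _ : Fin m => P)) / (2 * lam)
          + lam / 2 * (‖v‖ ^ 2 / n))
        + α ^ 2 * n ^ 2 * (((∫ e, lpNorm r e ^ 2 ∂(sphereUniform n)) / n *
            ∑ i, ∫ ξ, batchGradient F x ξ i * batchGradient F x ξ i ∂(Measure.pi fun _ : Fin m => P))
          + (∫ e, lpNorm r e ^ 2 ∂(sphereUniform n)) *
            ∫ ξ, diffErrorBound L t Δ ξ ∂(Measure.pi fun _ : Fin m => P)) := by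
  set pr := Measure.pi fun _ : Fin m => P
  have hg : ∀ i, MemLp (fun ξ => batchGradient F x ξ i) 2 pr := fun i =>
    memLp_batchMean (memLp_partial hF x i)
  have hgi : ∀ i, Integrable (fun ξ => batchGradient F x ξ i) pr := fun i =>
    (hg i).integrable one_le_two
  have hgv : ∀ i j, Integrable (fun ξ => batchGradient F x ξ i * v j) pr := fun i j =>
    (hgi i).mul_const _
  have hvv : ∀ i j, Integrable (fun _ : Fin m → 𝒳 => v i * v j) pr := fun i j => integrable_const _
  have hgg : ∀ i j, Integrable (fun ξ => batchGradient F x ξ i * batchGradient F x ξ j) pr :=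
    fun i j => (hg i).integrable_mul (hg j)
  have hQc : Continuous fun e : Vec n => lpNorm r e ^ 2 := (continuous_lpNorm hr).pow 2
  have hZ := integrable_diffErrorBound (m := m) hF.memLp t Δ
  have i1 := integrable_inner_mul_inner (ν := pr) (φ := fun _ : Vec n => 1) continuous_const
    (u := batchGradient F x) (w := fun _ => v) hgv
  have i2 := integrable_inner_mul_inner (ν := pr) (φ := fun _ : Vec n => 1) continuous_const
    (u := fun _ => v) (w := fun _ => v) hvv
  have i3 := integrable_inner_mul_inner (ν := pr) hQc
    (u := batchGradient F x) (w := batchGradient F x) hgg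
  have i4 := (integrable_sphereUniform_of_continuous hQc).mul_prod hZ
  have i5 : Integrable (fun z : Vec n × (Fin m → 𝒳) => diffErrorBound L t Δ z.2)
    ((sphereUniform n).prod pr) := hZ.comp_snd _
  have e1 := integral_inner_mul_inner (ν := pr) (isSymmetricFn_const 1) continuous_const
    (u := batchGradient F x) (w := fun _ => v) hgv
  have e2 := integral_inner_mul_inner (ν := pr) (isSymmetricFn_const 1) continuous_const
    (u := fun _ => v) (w := fun _ => v) hvv
  have e3 := integral_inner_mul_inner (ν := pr) (isSymmetricFn_lpNorm_sq r) hQc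
    (u := batchGradient F x) (w := batchGradient F x) hgg
  have e4 := integral_prod_mul (μ := sphereUniform n) (ν := pr) (fun e : Vec n => lpNorm r e ^ 2)
    (diffErrorBound L t Δ)
  have e5 : ∫ z : Vec n × (Fin m → 𝒳), diffErrorBound L t Δ z.2 ∂((sphereUniform n).prod pr)
      = ∫ ξ, diffErrorBound L t Δ ξ ∂pr := by
    rw [integral_fun_snd (diffErrorBound L t Δ)]; simp
  have e1' : ∑ i, ∫ ξ, batchGradient F x ξ i * v i ∂pr
      = inner ℝ (gradient (objective P F) x) v := by
    rw [inner_eq_sum, gradient_objective hF]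
    refine Finset.sum_congr rfl fun i _ => ?_
    rw [integral_mul_const]
    congr 1
    exact integral_batchMean (integrable_partial hF x i)
  have e2' : ∑ i, ∫ _ξ : Fin m → 𝒳, v i * v i ∂pr = ‖v‖ ^ 2 := by
    rw [EuclideanSpace.norm_sq_eq]
    simp only [Real.norm_eq_abs, sq_abs]
    simp [sq]
  have hn : (n : ℝ) ≠ 0 := NeZero.ne _
  rw [e1'] at e1
  rw [e2'] at e2
  simp only [integral_const, probReal_univ, smul_eq_mul, one_mul] at e1 e2
  have j1 := (i1.const_mul (α * n))
  have j2 := (((i5.div_const (2 * lam)).add (i2.const_mul (lam / 2))).const_mul (α * n))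
  have j3 := ((i3.add i4).const_mul (α ^ 2 * n ^ 2))
  have j0 := integrable_const (μ := (sphereUniform n).prod pr) W
  refine ⟨((j0.sub j1).add j2).add j3, ?_⟩
  simp only [stepBound]
  have k1 := integral_add ((j0.sub j1).add j2) j3
  have k2 := integral_add (j0.sub j1) j2
  have k3 := integral_sub j0 j1
  have k4 := integral_add (i5.div_const (2 * lam)) (i2.const_mul (lam / 2))
  have k5 := integral_add i3 i4
  simp only [Pi.add_apply, Pi.sub_apply, integral_const_mul, integral_div, e1, e2, e3, e4, e5,
    integral_const, probReal_univ, smul_eq_mul, one_mul] at k1 k2 k3 k4 k5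
  rw [k1, k2, k3, k4, k5]
  field_simp

/-- The expected progress of one step from a fixed point `x`. -/
lemma lintegral_step_le [NeZero m] {p : ℝ} {d : Vec n → ℝ} (hd : IsProxFunction p d) (hn : 8 ≤ n)
    (h1 : 1 ≤ p) (h2 : p ≤ 2) (hF : IsSmoothStochasticProblem P F L σ) {Δ t α lam L₂ : ℝ}
    (hL₂ : L₂ = smoothConst P L) (hL₂pos : 0 < L₂) (hη : IsBoundedNoise P η Δ) (hΔ : 0 < Δ)
    (ht : t = 2 * √(Δ / L₂)) (hα : α = 1 / (48 * n * rho p n * L₂)) (hlam : 0 < lam)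
    {xs : Vec n} (hxs : ∀ x, objective P F xs ≤ objective P F x) (x : Vec n) :
    (∫⁻ z, ENNReal.ofReal (bregman d (mirrorInv d (gradient d x - (α * n) •
        (gradEst (fun x z => F x z + η x z) t x z.1 z.2).1)) xs)
      ∂((sphereUniform n).prod (Measure.pi fun _ : Fin m => P)))
      + ENNReal.ofReal (α / 2 * (objective P F x - objective P F xs))
    ≤ ENNReal.ofReal ((1 + α * lam) * bregman d x xs
        + α * (σ ^ 2 / (8 * L₂ * m) + 5 / 4 * (n * Δ) + 5 * n * Δ * L₂ / lam)) := by
  have : NeZero n := ⟨by omega⟩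
  have hn0 : (0 : ℝ) < n := Nat.cast_pos.2 (NeZero.pos n)
  have hm0 : (0 : ℝ) < m := Nat.cast_pos.2 (NeZero.pos m)
  have hρ := rho_pos hn h1 h2
  have hα0 : 0 < α := by rw [hα]; positivity
  have ht0 : 0 < t := by rw [ht]; positivity
  have hr := two_le_dualExp hn h1 h2
  obtain ⟨hInt, heq⟩ := integrable_integral_stepBound (m := m) hF (r := dualExp p n) (by linarith)
    α lam (bregman d x xs) t Δ (x - xs) x
  have hae := ae_step_le (m := m) hd hn h1 h2 hF hη ht0 hα0.le hlam x xs
  have hnonneg : 0 ≤ᵐ[(sphereUniform n).prod (Measure.pi fun _ : Fin m => P)]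
      fun z => stepBound n α lam (bregman d x xs) (x - xs) (batchGradient F x z.2) z.1
        (diffErrorBound L t Δ z.2) (lpNorm (dualExp p n) z.1) := by
    filter_upwards [hae] with z hz using (bregman_nonneg hd _ _).trans hz
  have hle : (∫⁻ z, ENNReal.ofReal (bregman d (mirrorInv d (gradient d x - (α * n) •
        (gradEst (fun x z => F x z + η x z) t x z.1 z.2).1)) xs)
      ∂((sphereUniform n).prod (Measure.pi fun _ : Fin m => P)))
      ≤ ENNReal.ofReal (∫ z, stepBound n α lam (bregman d x xs) (x - xs) (batchGradient F x z.2) z.1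
        (diffErrorBound L t Δ z.2) (lpNorm (dualExp p n) z.1)
        ∂((sphereUniform n).prod (Measure.pi fun _ : Fin m => P))) := by
    rw [ofReal_integral_eq_lintegral_ofReal hInt hnonneg]
    refine lintegral_mono_ae ?_
    filter_upwards [hae] with z hz using ENNReal.ofReal_le_ofReal hz
  refine (add_le_add_left hle _).trans ?_
  have hD : 0 ≤ objective P F x - objective P F xs := sub_nonneg.2 (hxs x)
  rw [← ENNReal.ofReal_add (integral_nonneg_of_ae hnonneg) (by positivity)]
  refine ENNReal.ofReal_le_ofReal ?_
  rw [heq, integral_diffErrorBound hF.memLp (hL₂ ▸ hL₂pos) hΔ (hL₂ ▸ ht), ← hL₂]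
  set D := objective P F x - objective P F xs
  set W := bregman d x xs
  set Q := ∫ e, lpNorm (dualExp p n) e ^ 2 ∂(sphereUniform n)
  have hQ : Q ≤ 6 * rho p n := integral_lpNorm_dualExp_sq_le hn h1 h2
  have hQ0 : 0 ≤ Q := integral_nonneg fun e => sq_nonneg _
  have hG := integral_norm_batchGradient_sq_le (m := m) hF x
  set G := ∑ i, ∫ ξ, batchGradient F x ξ i * batchGradient F x ξ i ∂(Measure.pi fun _ : Fin m => P)
  have hgrad := norm_gradient_objective_sq_le hF (hL₂ ▸ hL₂pos) hxs x
  rw [← hL₂] at hgrad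
  have hconv : D ≤ inner ℝ (gradient (objective P F) x) (x - xs) :=
    sub_le_inner_gradient_of_convexOn (differentiable_objective hF) hF.convex x xs
  have hW : ‖x - xs‖ ^ 2 ≤ 2 * W := by
    have := half_norm_sq_le_bregman hd h1 h2 x xs
    rw [norm_sub_rev] at this
    linarith
  have b1 := mul_le_mul_of_nonneg_left hconv hα0.le
  have b2 : α * n * (10 * (Δ * L₂) / (2 * lam) + lam / 2 * (‖x - xs‖ ^ 2 / n))
      ≤ α * (5 * n * Δ * L₂ / lam) + α * lam * W := by
    calc _ = α * (5 * n * Δ * L₂ / lam) + α * lam / 2 * ‖x - xs‖ ^ 2 := by field_simp; ring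
      _ ≤ α * (5 * n * Δ * L₂ / lam) + α * lam / 2 * (2 * W) := by gcongr
      _ = _ := by ring
  have b3 : α ^ 2 * n ^ 2 * (Q / n * G + Q * (10 * (Δ * L₂)))
      ≤ α / 2 * D + α * (σ ^ 2 / (8 * L₂ * m) + 5 / 4 * (n * Δ)) := by
    calc _ ≤ α ^ 2 * n ^ 2 * (6 * rho p n / n * (4 * L₂ * D + σ ^ 2 / m)
          + 6 * rho p n * (10 * (Δ * L₂))) := by
          have hG' : G ≤ 4 * L₂ * D + σ ^ 2 / m := by linarith
          have : 0 ≤ G := Finset.sum_nonneg fun i _ => integral_nonneg fun ξ => mul_self_nonneg _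
          gcongr
      _ = α * (48 * n * rho p n * L₂ * α) * ((4 * L₂ * D + σ ^ 2 / m) / (8 * L₂)
          + 5 / 4 * (n * Δ)) := by field_simp; ring
      _ = _ := by
          have : 48 * n * rho p n * L₂ * α = 1 := by rw [hα]; field_simp
          rw [this]; field_simp; ring
  linarith

end Expectation

section RandomRecursion

variable {Ω S E : Type*} [MeasurableSpace S] [MeasurableSpace E]
  {Z : ℕ → Ω → S} {X : ℕ → Ω → E} {step : E → S → E}

lemma exists_measurable_of_recursion {x₀ : E} (hstep : Measurable (Function.uncurry step))
    (h0 : ∀ ω, X 0 ω = x₀) (hs : ∀ k ω, X (k + 1) ω = step (X k ω) (Z k ω)) (k : ℕ) :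
    ∃ Ψ : (Finset.range k → S) → E, Measurable Ψ ∧ ∀ ω, X k ω = Ψ fun i => Z i ω := by
  induction k with
  | zero => exact ⟨fun _ => x₀, measurable_const, h0⟩
  | succ k ih =>
    obtain ⟨Ψ, hΨ, hX⟩ := ih
    refine ⟨fun w => step (Ψ fun i => w ⟨i, Finset.mem_range.2
      ((Finset.mem_range.1 i.2).trans k.lt_succ_self)⟩) (w ⟨k, Finset.self_mem_range_succ k⟩),
      ?_, fun ω => ?_⟩
    · exact hstep.comp ((hΨ.comp (measurable_pi_lambda _ fun i => measurable_pi_apply _)).prodMk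
        (measurable_pi_apply _))
    · rw [hs, hX]

variable [MeasurableSpace Ω] {μ : Measure Ω}

lemma aemeasurable_of_recursion {x₀ : E} (hstep : Measurable (Function.uncurry step))
    (hZ : ∀ k, AEMeasurable (Z k) μ) (h0 : ∀ ω, X 0 ω = x₀)
    (hs : ∀ k ω, X (k + 1) ω = step (X k ω) (Z k ω)) (k : ℕ) : AEMeasurable (X k) μ := by
  obtain ⟨Ψ, hΨ, hX⟩ := exists_measurable_of_recursion hstep h0 hs k
  have : X k = fun ω => Ψ fun i => Z i ω := funext hX
  rw [this]
  exact hΨ.comp_aemeasurable (aemeasurable_pi_lambda _ fun i => hZ i)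

lemma indepFun_of_recursion {x₀ : E} (hstep : Measurable (Function.uncurry step))
    (hZ : ∀ k, AEMeasurable (Z k) μ) (hi : iIndepFun Z μ) (h0 : ∀ ω, X 0 ω = x₀)
    (hs : ∀ k ω, X (k + 1) ω = step (X k ω) (Z k ω)) (k : ℕ) : IndepFun (X k) (Z k) μ := by
  obtain ⟨Ψ, hΨ, hX⟩ := exists_measurable_of_recursion hstep h0 hs k
  have h := hi.indepFun_finset₀ (Finset.range k) {k} (by simp) hZ
  have h2 := h.comp hΨ (measurable_pi_apply (⟨k, Finset.mem_singleton_self k⟩ : ({k} : Finset ℕ)))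
  have : X k = Ψ ∘ fun ω (i : Finset.range k) => Z i ω := funext hX
  rw [this]
  exact h2

/-- Conditioning on the past of a recursion driven by independent inputs. -/
lemma lintegral_recursion_succ [IsProbabilityMeasure μ] {x₀ : E} {ν : Measure S} [IsProbabilityMeasure ν]
    (hstep : Measurable (Function.uncurry step))
    (hZ : ∀ k, HasLaw (Z k) ν μ) (hi : iIndepFun Z μ) (h0 : ∀ ω, X 0 ω = x₀)
    (hs : ∀ k ω, X (k + 1) ω = step (X k ω) (Z k ω)) {φ : E → ENNReal} (hφ : Measurable φ) (k : ℕ) :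
    ∫⁻ ω, φ (X (k + 1) ω) ∂μ = ∫⁻ ω, ∫⁻ z, φ (step (X k ω) z) ∂ν ∂μ := by
  have hZm : ∀ k, AEMeasurable (Z k) μ := fun k => (hZ k).aemeasurable
  have hXm := aemeasurable_of_recursion hstep hZm h0 hs k
  have hind := indepFun_of_recursion hstep hZm hi h0 hs k
  have hmap := (indepFun_iff_map_prod_eq_prod_map_map hXm (hZm k)).1 hind
  have hφs : Measurable fun q : E × S => φ (step q.1 q.2) := hφ.comp hstep
  have : IsProbabilityMeasure (μ.map (X k)) := Measure.isProbabilityMeasure_map hXm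
  simp_rw [hs]
  calc ∫⁻ ω, φ (step (X k ω) (Z k ω)) ∂μ
      = ∫⁻ q, φ (step q.1 q.2) ∂(μ.map fun ω => (X k ω, Z k ω)) := by
        rw [lintegral_map' hφs.aemeasurable (hXm.prodMk (hZm k))]
    _ = ∫⁻ x, ∫⁻ z, φ (step x z) ∂ν ∂(μ.map (X k)) := by
        rw [hmap, (hZ k).map_eq, lintegral_prod _ hφs.aemeasurable]
    _ = _ := by
        rw [lintegral_map' (Measurable.lintegral_prod_right' hφs).aemeasurable hXm]

end RandomRecursion

lemma add_sum_le_of_linear_recursion {v w : ℕ → ENNReal} {A b : ENNReal} (hA : 1 ≤ A)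
    (h : ∀ k, v (k + 1) + w k ≤ A * v k + b) (K : ℕ) :
    v K + ∑ k ∈ Finset.range K, w k ≤ A ^ K * (v 0 + K * b) := by
  induction K with
  | zero => simp
  | succ K ih =>
    rw [Finset.sum_range_succ]
    calc v (K + 1) + (∑ k ∈ Finset.range K, w k + w K)
        = (v (K + 1) + w K) + ∑ k ∈ Finset.range K, w k := by ring
      _ ≤ (A * v K + b) + A * ∑ k ∈ Finset.range K, w k :=
          add_le_add (h K) (le_mul_of_one_le_left zero_le hA)
      _ = A * (v K + ∑ k ∈ Finset.range K, w k) + 1 * b := by ring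
      _ ≤ A * (A ^ K * (v 0 + K * b)) + A ^ (K + 1) * b := by
          gcongr
          exact one_le_pow₀ hA
      _ = _ := by push_cast; ring

section Method

variable {𝒳 : Type*} {n m : ℕ}

/-- One step of the method from `x`, with direction `z.1` and batch `z.2`. -/
def mirrorStep (d : Vec n → ℝ) (fn : Vec n → 𝒳 → ℝ) (α t : ℝ) (x : Vec n)
    (z : Vec n × (Fin m → 𝒳)) : Vec n :=
  mirrorInv d (gradient d x - (α * n) • (gradEst fn t x z.1 z.2).1)

lemma rdfds_snd (d : Vec n → ℝ) (fn : Vec n → 𝒳 → ℝ) (α t : ℝ) (e : ℕ → Vec n)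
    (ξ : ℕ → Fin m → 𝒳) (x₀ : Vec n) (k : ℕ) : (rdfds d fn α t e ξ x₀ k).2 = k * m := by
  induction k with
  | zero => simp [rdfds]
  | succ k ih => simp only [rdfds, ih, gradEst_eq]; ring

lemma rdfds_fst_succ {p : ℝ} {d : Vec n → ℝ} (hd : IsProxFunction p d) (h1 : 1 ≤ p) (h2 : p ≤ 2)
    (fn : Vec n → 𝒳 → ℝ) (α t : ℝ) (e : ℕ → Vec n) (ξ : ℕ → Fin m → 𝒳) (x₀ : Vec n) (k : ℕ) :
    (rdfds d fn α t e ξ x₀ (k + 1)).1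
      = mirrorStep d fn α t (rdfds d fn α t e ξ x₀ k).1 (e k, ξ k) := by
  rw [mirrorStep, ← argminPt_eq_mirrorInv hd h1 h2]
  simp only [rdfds, real_inner_smul_left]

variable [MeasurableSpace 𝒳]

lemma measurable_mirrorStep {p : ℝ} {d : Vec n → ℝ} (hd : IsProxFunction p d) (h1 : 1 ≤ p)
    (h2 : p ≤ 2) {fn : Vec n → 𝒳 → ℝ} (hfn : Measurable (Function.uncurry fn)) (α t : ℝ) :
    Measurable (Function.uncurry (mirrorStep (m := m) d fn α t)) := by
  have hg := measurable_gradient d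
  have hm := (continuous_mirrorInv hd h1 h2).measurable
  have hfn' : ∀ k : Fin m, Measurable fun q : Vec n × (Vec n × (Fin m → 𝒳)) =>
      (fn (q.1 + t • q.2.1) (q.2.2 k) - fn q.1 (q.2.2 k)) / t := by
    intro k
    have a : Measurable fun q : Vec n × (Vec n × (Fin m → 𝒳)) => q.2.2 k :=
      (measurable_pi_apply k).comp (measurable_snd.comp measurable_snd)
    exact ((hfn.comp ((by fun_prop : Measurable fun q : Vec n × (Vec n × (Fin m → 𝒳)) =>
      q.1 + t • q.2.1).prodMk a)).sub (hfn.comp (measurable_fst.prodMk a))).div_const t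
  refine hm.comp ((hg.comp measurable_fst).sub (Measurable.const_smul ?_ (α * n : ℝ)))
  simp only [gradEst_eq, batchMean]
  exact ((Finset.measurable_sum _ fun k _ => hfn' k).const_mul _).smul
    (measurable_fst.comp measurable_snd)

lemma one_add_inv_pow_le_three {N : ℕ} (hN : 1 ≤ N) : (1 + 1 / (N : ℝ)) ^ N ≤ 3 := by
  have hN0 : (0 : ℝ) < N := by exact_mod_cast hN
  calc (1 + 1 / (N : ℝ)) ^ N ≤ (Real.exp (1 / N)) ^ N := by
        gcongr
        linarith [Real.add_one_le_exp (1 / (N : ℝ))]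
    _ = Real.exp 1 := by rw [← Real.exp_nat_mul]; congr 1; field_simp
    _ ≤ 3 := by linarith [Real.exp_one_lt_d9]

/-- The convergence rate of the method. -/
lemma integrable_expected_gap_le {p : ℝ} {d : Vec n → ℝ} (hd : IsProxFunction p d) (hn : 8 ≤ n)
    (h1 : 1 ≤ p) (h2 : p ≤ 2) {P : Measure 𝒳} [IsProbabilityMeasure P]
    {F η : Vec n → 𝒳 → ℝ} {L : 𝒳 → ℝ} {σ : ℝ} (hF : IsSmoothStochasticProblem P F L σ)
    {Δ t α L₂ : ℝ} (hL₂ : L₂ = smoothConst P L) (hL₂pos : 0 < L₂) (hη : IsBoundedNoise P η Δ)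
    (hΔ : 0 < Δ) (ht : t = 2 * √(Δ / L₂)) (hα : α = 1 / (48 * n * rho p n * L₂))
    {x₀ xs : Vec n} (hxs : ∀ x, objective P F xs ≤ objective P F x)
    {N : ℕ} (hN : 1 ≤ N) (hm : 1 ≤ m)
    {Ω : Type*} [MeasurableSpace Ω] {μ : Measure Ω} [IsProbabilityMeasure μ]
    {e : ℕ → Ω → Vec n} {ξ : ℕ → Ω → Fin m → 𝒳} (hs : IsSampling μ P e ξ) :
    Integrable (fun ω => objective P F (rdfdsOutput d (fun x z => F x z + η x z) α t
        (fun k => e k ω) (fun k => ξ k ω) x₀ N)) μ ∧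
      ∫ ω, objective P F (rdfdsOutput d (fun x z => F x z + η x z) α t
        (fun k => e k ω) (fun k => ξ k ω) x₀ N) ∂μ - objective P F xs
      ≤ 6 * (bregman d x₀ xs / (N * α) + (σ ^ 2 / (8 * L₂ * m) + 5 / 4 * (n * Δ)
        + 5 * n * Δ * L₂ * (α * N))) := by
  have : NeZero m := ⟨by omega⟩
  have : NeZero n := ⟨by omega⟩
  have hn0 : (0 : ℝ) < n := Nat.cast_pos.2 (NeZero.pos n)
  have hm0 : (0 : ℝ) < m := Nat.cast_pos.2 (NeZero.pos m)
  have hN0 : (0 : ℝ) < N := by exact_mod_cast hN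
  have hρ := rho_pos hn h1 h2
  have hα0 : 0 < α := by rw [hα]; positivity
  set f := objective P F with hf
  have hfc : Continuous f := (differentiable_objective hF).continuous
  set fn : Vec n → 𝒳 → ℝ := fun x z => F x z + η x z with hfn
  have hfnm : Measurable (Function.uncurry fn) := hF.measurable.add hη.measurable
  set X : ℕ → Ω → Vec n := fun k ω =>
    (rdfds d fn α t (fun k => e k ω) (fun k => ξ k ω) x₀ k).1 with hX
  set Z : ℕ → Ω → Vec n × (Fin m → 𝒳) := fun k ω => (e k ω, ξ k ω) with hZ
  set B := σ ^ 2 / (8 * L₂ * m) + 5 / 4 * (n * Δ) + 5 * n * Δ * L₂ * (α * N) with hB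
  have hB0 : 0 ≤ B := by positivity
  have hΘ := bregman_nonneg hd x₀ xs
  have hX0 : ∀ ω, X 0 ω = x₀ := fun ω => rfl
  have hXs : ∀ k ω, X (k + 1) ω = mirrorStep d fn α t (X k ω) (Z k ω) := fun k ω =>
    rdfds_fst_succ hd h1 h2 fn α t _ _ x₀ k
  have hstep := measurable_mirrorStep (m := m) hd h1 h2 hfnm α t
  have hXm : ∀ k, AEMeasurable (X k) μ := fun k =>
    aemeasurable_of_recursion hstep (fun k => (hs.law k).aemeasurable) hX0 hXs k
  set v : ℕ → ENNReal := fun k => ∫⁻ ω, ENNReal.ofReal (bregman d (X k ω) xs) ∂μ with hv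
  set w : ℕ → ENNReal := fun k => ∫⁻ ω, ENNReal.ofReal (α / 2 * (f (X k ω) - f xs)) ∂μ with hw
  have hYm : ∀ k, AEMeasurable (fun ω => α / 2 * (f (X k ω) - f xs)) μ := fun k =>
    ((hfc.measurable.comp_aemeasurable (hXm k)).sub_const _).const_mul _
  have hrec : ∀ k, v (k + 1) + w k
      ≤ ENNReal.ofReal (1 + 1 / N) * v k + ENNReal.ofReal (α * B) := by
    intro k
    have hlam : 0 < 1 / (α * N) := by positivity
    have hbm : Measurable fun z => ENNReal.ofReal (bregman d z xs) :=
      (measurable_bregman hd xs).ennreal_ofReal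
    calc v (k + 1) + w k
        = ∫⁻ ω, ((∫⁻ z, ENNReal.ofReal (bregman d (mirrorStep d fn α t (X k ω) z) xs)
            ∂((sphereUniform n).prod (Measure.pi fun _ : Fin m => P)))
          + ENNReal.ofReal (α / 2 * (f (X k ω) - f xs))) ∂μ := by
          rw [lintegral_add_right' _ (hYm k).ennreal_ofReal]
          congr 1
          exact lintegral_recursion_succ hstep hs.law hs.indep hX0 hXs hbm k
      _ ≤ ∫⁻ ω, (ENNReal.ofReal (1 + 1 / N) * ENNReal.ofReal (bregman d (X k ω) xs)
          + ENNReal.ofReal (α * B)) ∂μ := by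
          refine lintegral_mono fun ω => ?_
          refine (lintegral_step_le hd hn h1 h2 hF hL₂ hL₂pos hη hΔ ht hα hlam hxs (X k ω)).trans ?_
          rw [← ENNReal.ofReal_mul (by positivity), ← ENNReal.ofReal_add
            (mul_nonneg (by positivity) (bregman_nonneg hd _ _)) (by positivity)]
          refine le_of_eq ?_
          congr 1
          rw [hB]
          field_simp
      _ = _ := by
          rw [lintegral_add_right _ measurable_const, lintegral_const_mul' _ _
            ENNReal.ofReal_ne_top]
          simp [hv]
  have hmain := add_sum_le_of_linear_recursion (A := ENNReal.ofReal (1 + 1 / N))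
    (by rw [ENNReal.one_le_ofReal]; linarith [show 0 ≤ 1 / (N : ℝ) by positivity]) hrec N
  have hv0 : v 0 = ENNReal.ofReal (bregman d x₀ xs) := by simp [hv, hX0]
  have hsum : ∑ k ∈ Finset.range N, w k
      ≤ ENNReal.ofReal (3 * (bregman d x₀ xs + N * (α * B))) := by
    refine (le_add_self.trans hmain).trans ?_
    rw [hv0, ← ENNReal.ofReal_pow (by positivity), ← ENNReal.ofReal_natCast,
      ← ENNReal.ofReal_mul (by positivity), ← ENNReal.ofReal_add hΘ (by positivity),
      ← ENNReal.ofReal_mul (by positivity)]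
    refine ENNReal.ofReal_le_ofReal ?_
    gcongr
    exact one_add_inv_pow_le_three hN
  have hwfin : ∀ k ∈ Finset.range N, w k ≠ ⊤ := fun k hk =>
    ne_top_of_le_ne_top ENNReal.ofReal_ne_top
      ((Finset.single_le_sum (f := w) (fun _ _ => zero_le) hk).trans hsum)
  have hYpos : ∀ k ω, 0 ≤ α / 2 * (f (X k ω) - f xs) := fun k ω =>
    mul_nonneg (by positivity) (sub_nonneg.2 (hxs _))
  have hYint : ∀ k ∈ Finset.range N, Integrable (fun ω => α / 2 * (f (X k ω) - f xs)) μ :=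
    fun k hk => (lintegral_ofReal_ne_top_iff_integrable (hYm k).aestronglyMeasurable
      (ae_of_all _ (hYpos k))).1 (hwfin k hk)
  have hsumint : ∑ k ∈ Finset.range N, ∫ ω, α / 2 * (f (X k ω) - f xs) ∂μ
      ≤ 3 * (bregman d x₀ xs + N * (α * B)) := by
    rw [← ENNReal.ofReal_le_ofReal_iff (by positivity), ENNReal.ofReal_sum_of_nonneg
      fun k _ => integral_nonneg (hYpos k)]
    refine le_trans (le_of_eq (Finset.sum_congr rfl fun k hk => ?_)) hsum
    exact ofReal_integral_eq_lintegral_ofReal (hYint k hk) (ae_of_all _ (hYpos k))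
  set O : Ω → Vec n := fun ω => rdfdsOutput d fn α t (fun k => e k ω) (fun k => ξ k ω) x₀ N with hO
  have hOm : AEMeasurable O μ := by
    have : O = fun ω => (1 / (N : ℝ)) • ∑ k ∈ Finset.range N, X k ω := rfl
    rw [this]
    exact (Finset.aemeasurable_fun_sum _ fun k _ => hXm k).fun_const_smul _
  have hjensen : ∀ ω, f (O ω) - f xs
      ≤ 2 / (N * α) * ∑ k ∈ Finset.range N, α / 2 * (f (X k ω) - f xs) := by
    intro ω
    have hj := hF.convex.map_sum_le (t := Finset.range N) (w := fun _ => 1 / (N : ℝ))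
      (p := fun k => X k ω) (fun _ _ => by positivity) (by simp; field_simp) (fun _ _ => trivial)
    have hO' : O ω = ∑ k ∈ Finset.range N, (1 / (N : ℝ)) • X k ω := by
      rw [← Finset.smul_sum]; rfl
    rw [← hO', ← hf] at hj
    simp only [smul_eq_mul, ← Finset.mul_sum] at hj
    rw [← Finset.mul_sum, Finset.sum_sub_distrib]
    simp only [Finset.sum_const, Finset.card_range, nsmul_eq_mul]
    calc f (O ω) - f xs ≤ 1 / (N : ℝ) * ∑ k ∈ Finset.range N, f (X k ω) - f xs := by linarith
      _ = _ := by field_simp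
  have hdom : Integrable (fun ω => 2 / (N * α) *
      ∑ k ∈ Finset.range N, α / 2 * (f (X k ω) - f xs)) μ :=
    (integrable_finsetSum _ hYint).const_mul _
  have hgap : Integrable (fun ω => f (O ω) - f xs) μ := by
    refine hdom.mono' ((hfc.measurable.comp_aemeasurable hOm).sub_const _).aestronglyMeasurable
      (ae_of_all _ fun ω => ?_)
    rw [Real.norm_of_nonneg (sub_nonneg.2 (hxs _))]
    exact hjensen ω
  have hOint : Integrable (fun ω => f (O ω)) μ := by
    refine (hgap.add (integrable_const (f xs))).congr (ae_of_all _ fun ω => ?_)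
    simp
  refine ⟨hOint, ?_⟩
  have hI := integral_mono hgap hdom hjensen
  rw [integral_sub hOint (integrable_const _), integral_const_mul,
    integral_finsetSum _ hYint] at hI
  simp only [integral_const, probReal_univ, smul_eq_mul, one_mul] at hI
  refine hI.trans ?_
  calc _ ≤ 2 / (N * α) * (3 * (bregman d x₀ xs + N * (α * B))) := by gcongr
    _ = _ := by field_simp; ring

end Method

section Parameters

lemma smoothing_le {C c₁ ε L₂ Δ Θ t : ℝ} {n : ℕ} (hn : 0 < (n : ℝ)) (hC : 2 ≤ C) (hc : c₁ ≤ 1)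
    (hε : 0 < ε) (hL : 0 < L₂) (hΔ : 0 < Δ) (h1 : Δ ≤ c₁ * (ε / n))
    (h2 : Δ * (n * L₂ * Θ) ≤ c₁ * ε ^ 2) (ht : t = 2 * √(Δ / L₂)) :
    t ≤ C * √(ε / (n * L₂)) ∧ t * √(n * L₂ ^ 2 * Θ) ≤ C * ε := by
  have hΔ' : Δ ≤ ε / n := h1.trans (mul_le_of_le_one_left (by positivity) hc)
  constructor
  · rw [ht]
    have : Δ / L₂ ≤ ε / (n * L₂) := by
      rw [← div_div]; gcongr
    gcongr
  · rw [ht, mul_assoc, ← Real.sqrt_mul (by positivity)]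
    have e : Δ / L₂ * (n * L₂ ^ 2 * Θ) = Δ * (n * L₂ * Θ) := by field_simp
    have h3 : √(Δ / L₂ * (n * L₂ ^ 2 * Θ)) ≤ ε := by
      rw [e]
      refine (Real.sqrt_le_left hε.le).2 (h2.trans ?_)
      exact mul_le_of_le_one_left (by positivity) hc
    gcongr

lemma rate_le {C ε L₂ Δ Θ σ ρ α n N m : ℝ} (hn : 0 < n) (hρ : 0 < ρ)
    (hnρ : 1 ≤ n * ρ) (hC : 1152 ≤ C) (hε : 0 < ε) (hL : 0 < L₂) (hΔ : 0 < Δ) (hΘ : 0 ≤ Θ)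
    (hN : 0 < N) (hm : 0 < m) (hN1 : 1152 * (n * ρ * L₂ * Θ / ε) ≤ N)
    (hN2 : N ≤ C * max 1 (n * ρ * L₂ * Θ / ε)) (hm1 : 1152 * (σ ^ 2 / (ε * L₂)) ≤ m)
    (h1 : Δ ≤ 1 / (100 * C) * (ε / n)) (h2 : Δ * (n * L₂ * Θ) ≤ 1 / (100 * C) * ε ^ 2)
    (hα : α = 1 / (48 * n * ρ * L₂)) :
    6 * (Θ / (N * α) + (σ ^ 2 / (8 * L₂ * m) + 5 / 4 * (n * Δ) + 5 * n * Δ * L₂ * (α * N))) ≤ ε := by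
  have hC0 : 0 < C := by linarith
  have b1 : Θ / (N * α) ≤ ε / 24 := by
    have e : Θ / (N * α) = 48 * (n * ρ * L₂ * Θ / ε) * (ε / N) := by rw [hα]; field_simp
    rw [e]
    calc _ ≤ N / 24 * (ε / N) := by gcongr; linarith
      _ = _ := by field_simp
  have b2 : σ ^ 2 / (8 * L₂ * m) ≤ ε / 24 := by
    have e : σ ^ 2 / (8 * L₂ * m) = 1 / 8 * (σ ^ 2 / (ε * L₂)) * (ε / m) := by field_simp
    rw [e]
    calc _ ≤ m / 24 * (ε / m) := by
          have : 0 ≤ σ ^ 2 / (ε * L₂) := by positivity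
          gcongr; linarith
      _ = _ := by field_simp
  have hc : 1 / (100 * C) ≤ 1 / 100 := by
    gcongr; linarith
  have b3 : n * Δ ≤ ε / 100 := by
    calc n * Δ ≤ n * (1 / 100 * (ε / n)) := by
          gcongr
          exact h1.trans (by gcongr)
      _ = _ := by field_simp
  have b4 : 5 * n * Δ * L₂ * (α * N) ≤ ε / 100 := by
    have e : 5 * n * Δ * L₂ * (α * N) = 5 / 48 * (Δ / ρ) * N := by rw [hα]; field_simp
    have hy : 0 ≤ n * ρ * L₂ * Θ / ε := by positivity
    have hmax : max 1 (n * ρ * L₂ * Θ / ε) ≤ 1 + n * ρ * L₂ * Θ / ε :=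
      max_le (by linarith) (by linarith)
    have hNle : N ≤ C * (1 + n * ρ * L₂ * Θ / ε) := hN2.trans (by gcongr)
    have c1 : C * (Δ / ρ) ≤ ε / 100 := by
      calc C * (Δ / ρ) ≤ C * (1 / (100 * C) * (ε / n) / ρ) := by gcongr
        _ = ε / 100 / (n * ρ) := by field_simp
        _ ≤ ε / 100 := div_le_self (by positivity) hnρ
    have c2 : C * (Δ / ρ) * (n * ρ * L₂ * Θ / ε) ≤ ε / 100 := by
      calc _ = C * (Δ * (n * L₂ * Θ)) / ε := by field_simp
        _ ≤ C * (1 / (100 * C) * ε ^ 2) / ε := by gcongr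
        _ = _ := by field_simp
    rw [e]
    calc _ ≤ 5 / 48 * (Δ / ρ) * (C * (1 + n * ρ * L₂ * Θ / ε)) := by gcongr
      _ = 5 / 48 * (C * (Δ / ρ) + C * (Δ / ρ) * (n * ρ * L₂ * Θ / ε)) := by ring
      _ ≤ _ := by linarith
  linarith

lemma calls_le {C y s N m : ℝ} (hC : 0 < C) (hm : 0 ≤ m) (hN2 : N ≤ C * max 1 y)
    (hm2 : m ≤ C * max 1 s) : N * m ≤ C ^ 2 * (max 1 y * max 1 s) := by
  calc N * m ≤ (C * max 1 y) * (C * max 1 s) := by gcongr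
    _ = _ := by ring

end Parameters

end ZerothOrder

end

theorem corollary2 :
    (∀ n : ℕ, 8 ≤ n → IsProxFunction 1 (proxOne n)) ∧
    (∀ n : ℕ, 8 ≤ n → IsProxFunction 2 (proxTwo n)) ∧
    ∃ c₀ : ℝ, 0 < c₀ ∧ ∀ C : ℝ, c₀ ≤ C → ∃ c₁ : ℝ, 0 < c₁ ∧
      ∀ (n : ℕ) (_ : 8 ≤ n) (p : ℝ) (_ : 1 ≤ p) (_ : p ≤ 2)
        (d : Vec n → ℝ) (_ : IsProxFunction p d)
        (𝒳 : Type*) [MeasurableSpace 𝒳] (P : Measure 𝒳) [IsProbabilityMeasure P]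
        (F : Vec n → 𝒳 → ℝ) (L : 𝒳 → ℝ) (σ : ℝ) (_ : IsSmoothStochasticProblem P F L σ)
        (L₂ : ℝ) (_ : L₂ = smoothConst P L) (_ : 0 < L₂)
        (x₀ xs : Vec n) (_ : ∀ x, objective P F xs ≤ objective P F x)
        (Θ : ℝ) (_ : Θ = bregman d x₀ xs)
        (ε : ℝ) (_ : 0 < ε)
        (N : ℕ) (_ : 1 ≤ N)
        (_ : c₀ * (n * rho p n * L₂ * Θ / ε) ≤ N)
        (_ : N ≤ C * max 1 (n * rho p n * L₂ * Θ / ε))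
        (m : ℕ) (_ : 1 ≤ m) (_ : c₀ * (σ ^ 2 / (ε * L₂)) ≤ m)
        (_ : m ≤ C * max 1 (σ ^ 2 / (ε * L₂)))
        (Δ : ℝ) (_ : 0 < Δ) (_ : Δ ≤ c₁ * (ε / n)) (_ : Δ * (n * L₂ * Θ) ≤ c₁ * ε ^ 2)
        (η : Vec n → 𝒳 → ℝ) (_ : IsBoundedNoise P η Δ)
        (t : ℝ) (_ : t = 2 * √(Δ / L₂))
        (α : ℝ) (_ : α = 1 / (48 * n * rho p n * L₂))
        (Ω : Type*) [MeasurableSpace Ω] (μ : Measure Ω) [IsProbabilityMeasure μ]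
        (e : ℕ → Ω → Vec n) (ξ : ℕ → Ω → Fin m → 𝒳) (_ : IsSampling μ P e ξ),
        -- the smoothing parameter has the claimed order
        (t ≤ C * √(ε / (n * L₂)) ∧ t * √(n * L₂ ^ 2 * Θ) ≤ C * ε) ∧
        -- the output is an `ε`-solution in expectation
        (Integrable (fun ω => objective P F (rdfdsOutput d (fun x z => F x z + η x z) α t
            (fun k => e k ω) (fun k => ξ k ω) x₀ N)) μ ∧
          ∫ ω, objective P F (rdfdsOutput d (fun x z => F x z + η x z) α t
            (fun k => e k ω) (fun k => ξ k ω) x₀ N) ∂μ - objective P F xs ≤ ε) ∧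
        -- the number of oracle calls
        (∀ ω, ∀ T : ℕ, T = (rdfds d (fun x z => F x z + η x z) α t
            (fun k => e k ω) (fun k => ξ k ω) x₀ N).2 →
          T = N * m ∧
          T ≤ C ^ 2 * (max 1 (n * rho p n * L₂ * Θ / ε) * max 1 (σ ^ 2 / (ε * L₂))) ∧
          (ε ≤ n * rho p n * L₂ * Θ →
            T ≤ C ^ 2 * max (n * rho p n * L₂ * Θ / ε) (n * rho p n * σ ^ 2 * Θ / ε ^ 2)) ∧
          (p = 1 → ε ≤ n * rho p n * L₂ * Θ →
            T ≤ 16 * C ^ 2 *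
              max (L₂ * Θ * Real.log n / ε) (σ ^ 2 * Θ * Real.log n / ε ^ 2))) := by
  refine ⟨fun n hn => isProxFunction_proxOne hn, fun n _ => isProxFunction_proxTwo n,
    1152, by norm_num, fun C hC => ⟨1 / (100 * C), by positivity, ?_⟩⟩
  intro n hn p h1 h2 d hd 𝒳 _ P _ F L σ hF L₂ hL₂ hL₂pos x₀ xs hxs Θ hΘ ε hε N hN hN1 hN2 m hm hm1
    hm2 Δ hΔ hΔ1 hΔ2 η hη t ht α hα Ω _ μ _ e ξ hs
  have hn0 : (0 : ℝ) < n := by exact_mod_cast (by omega : 0 < n)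
  have hN0 : (0 : ℝ) < N := by exact_mod_cast hN
  have hm0 : (0 : ℝ) < m := by exact_mod_cast hm
  have hC0 : 0 < C := by linarith
  have hc1 : 1 / (100 * C) ≤ 1 := by rw [div_le_one (by positivity)]; linarith
  have hΘ0 : 0 ≤ Θ := hΘ ▸ bregman_nonneg hd x₀ xs
  have hρ := rho_pos hn h1 h2
  refine ⟨smoothing_le hn0 (by linarith) hc1 hε hL₂pos hΔ hΔ1 hΔ2 ht, ?_, ?_⟩
  · obtain ⟨hInt, hle⟩ := integrable_expected_gap_le (x₀ := x₀) hd hn h1 h2 hF hL₂ hL₂pos hη hΔ ht hα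
      hxs hN hm hs
    refine ⟨hInt, hle.trans ?_⟩
    rw [← hΘ]
    exact rate_le hn0 hρ (one_le_card_mul_rho hn h1 h2) hC hε hL₂pos hΔ hΘ0 hN0 hm0 hN1 hN2 hm1
      hΔ1 hΔ2 hα
  · rintro ω T rfl
    rw [rdfds_snd]
    push_cast
    have hcalls := calls_le hC0 hm0.le hN2 hm2
    have hlin : ε ≤ n * rho p n * L₂ * Θ → (N * m : ℝ) ≤ C ^ 2 *
        max (n * rho p n * L₂ * Θ / ε) (n * rho p n * σ ^ 2 * Θ / ε ^ 2) := by
      intro h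
      have hy : 1 ≤ n * rho p n * L₂ * Θ / ε := by rwa [le_div_iff₀ hε, one_mul]
      rw [max_eq_right hy, mul_max_of_nonneg _ _ (by linarith), mul_one] at hcalls
      have e1 : n * rho p n * L₂ * Θ / ε * (σ ^ 2 / (ε * L₂))
          = n * rho p n * σ ^ 2 * Θ / ε ^ 2 := by field_simp
      rwa [e1] at hcalls
    refine ⟨rfl, hcalls, hlin, fun hp h => (hlin h).trans ?_⟩
    subst hp
    have hlog := card_mul_rho_one_le hn
    have e2 : 16 * C ^ 2 * max (L₂ * Θ * Real.log n / ε) (σ ^ 2 * Θ * Real.log n / ε ^ 2)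
        = C ^ 2 * max (16 * Real.log n * L₂ * Θ / ε) (16 * Real.log n * σ ^ 2 * Θ / ε ^ 2) := by
      rw [mul_comm 16, mul_assoc, mul_max_of_nonneg _ _ (by norm_num : (0 : ℝ) ≤ 16)]
      congr 2 <;> ring
    rw [e2]
    gcongr
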